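/- Let $D([0,\infty))$ be the set of functions $x:[0,\infty)\to\mathbb R$ that are right-continuous at every $t\ge 0$ and have a finite left limit at every $t>0$. For $T>0$ let $\mathbb A([0,T])$ be the set of continuous functions $A:[0,T]\to\mathbb R$ of finite variation with $A(0)=0$; write $A_n\to_\tau A_0$ if $\sup_{t\in[0,T]}|A_n(t)-A_0(t)|\to 0$ and the total variations of the $A_n$ on $[0,T]$ are bounded uniformly in $n$. For $x_n,x_0\in D([0,\infty))$ write $x_n\xrightarrow{*}_S x_0$ if for every $T>0$ $$\int_0^T x_n(t)\,dA_n(t)\longrightarrow\int_0^T x_0(t)\,dA_0(t)$$ for all sequences $(A_n)$ in $\mathbb A([0,T])$ and all $A_0\in\mathbb A([0,T])$ such that $A_n\to_\tau A_0$. (The $S$ topology on $D([0,\infty))$ is the sequential topology generated by this convergence.) For $x\in D([0,\infty))$ and $T>0$ let $x^T$ be the restriction of $x$ to $[0,T]$ and $\|x^T\|_\infty=\sup_{t\in[0,T]}|x(t)|$. For $a<b$ let $N^{a,b}(x^T)$ be the largest integer $k$ such that there are $0\le t_1<t_2<\dots<t_{2k-1}<t_{2k}\le T$ with $x(t_{2i-1})<a$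 and $x(t_{2i})>b$ for $i=1,\dots,k$. For $\eta>0$ let $N_\eta(x^T)$ be the largest integer $k$ such that there are $0\le t_1<t_2\le t_3<t_4\le\dots\le t_{2k-1}<t_{2k}\le T$ with $|x(t_{2i})-x(t_{2i-1})|>\eta$ for $i=1,\dots,k$. **Theorem.** Let $K\subset D([0,\infty))$. The following two conditions are equivalent: (i) $\sup_{x\in K}\|x^T\|_\infty<\infty$ for every $T>0$, and $\sup_{x\in K}N^{a,b}(x^T)<\infty$ for all $T>0$ and all $a<b$; (ii) $\sup_{x\in K}\|x^T\|_\infty<\infty$ for every $T>0$, and $\sup_{x\in K}N_\eta(x^T)<\infty$ for all $T>0$ and all $\eta>0$. Moreover, every sequence $(x_n)$ of elements of $K$ has a subsequence $(x_{n_k})$ with $x_{n_k}\xrightarrow{*}_S x_0$ for some $x_0\in D([0,\infty))$ (not necessarily in $K$) if and only if (i), equivalently (ii), holds. -/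

import Mathlib

open Set Filter Topology MeasureTheory
open scoped NNReal ENNReal

noncomputable section

namespace STopology

/-- The Skorokhod space `D([0,∞))`: functions `x : [0,∞) → ℝ` which are right-continuous at every
`t ≥ 0` and have a finite left limit at every `t > 0`. -/
def SkorokhodSpace : Type :=
  {x : ℝ≥0 → ℝ //
    (∀ t, ContinuousWithinAt x (Ici t) t) ∧ ∀ t, 0 < t → ∃ l : ℝ, Tendsto x (𝓝[<] t) (𝓝 l)}

/-- The restriction `x^T` of `x ∈ D([0,∞))` to `[0,T]`. -/
def SkorokhodSpace.restrict (x : SkorokhodSpace) (T : ℝ≥0) : Icc (0 : ℝ≥0) T → ℝ :=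
  fun t => x.1 t

section Functionals

variable {α : Type*} [LinearOrder α]

/-- The sup norm of a function, as an extended nonnegative real. -/
def supNorm (f : α → ℝ) : ℝ≥0∞ := ⨆ t, ‖f t‖ₑ

/-- The number of up-crossings of the levels `a`, `b` by `f`: the largest `k` (in `ℕ∞`) for which
there are points `s 0 < t 0 < s 1 < t 1 < ⋯ < s (k-1) < t (k-1)` with `f (s i) < a` and
`b < f (t i)` for all `i`. -/
def upcrossingNumber (a b : ℝ) (f : α → ℝ) : ℕ∞ :=
  ⨆ (k : ℕ) (_ : ∃ s t : Fin k → α, (∀ i, s i < t i) ∧ (∀ i j, i < j → t i < s j) ∧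
    ∀ i, f (s i) < a ∧ b < f (t i)), (k : ℕ∞)

/-- The number of `η`-oscillations of `f`: the largest `k` (in `ℕ∞`) for which there are points
`s 0 < t 0 ≤ s 1 < t 1 ≤ ⋯ ≤ s (k-1) < t (k-1)` with `|f (t i) - f (s i)| > η` for all `i`. -/
def oscillationNumber (η : ℝ) (f : α → ℝ) : ℕ∞ :=
  ⨆ (k : ℕ) (_ : ∃ s t : Fin k → α, (∀ i, s i < t i) ∧ (∀ i j, i < j → t i ≤ s j) ∧
    ∀ i, η < |f (t i) - f (s i)|), (k : ℕ∞)

end Functionals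

/-- The family `𝔸([0,T])` of continuous functions `A : [0,T] → ℝ` of finite variation
with `A(0) = 0`. -/
structure Integrator (T : ℝ≥0) where
  toFun : Icc (0 : ℝ≥0) T → ℝ
  continuous : Continuous toFun
  boundedVariation : BoundedVariationOn toFun univ
  map_zero : toFun ⟨0, left_mem_Icc.2 (zero_le : 0 ≤ T)⟩ = 0

/-- The convergence `A n → A₀` in `𝔸([0,T])`: uniform convergence on `[0,T]` with uniformly bounded
total variations (recall that the functions vanish at `0`). -/
def TauConverges {T : ℝ≥0} (A : ℕ → Integrator T) (A₀ : Integrator T) : Prop :=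
  TendstoUniformly (fun n => (A n).toFun) A₀.toFun atTop ∧
    (⨆ n, eVariationOn (A n).toFun univ) < ∞

instance compactIccSpace_Icc (T : ℝ≥0) : CompactIccSpace (Icc (0 : ℝ≥0) T) :=
  ⟨fun {_ _} => isClosed_Icc.isCompact⟩

/-- The Stieltjes integral `∫₀ᵀ f dA` on `[0,T]`, i.e. the integral of `f` with respect to the
signed measure on `[0,T]` with distribution function `A`. -/
def stieltjesIntegral {T : ℝ≥0} (f : Icc (0 : ℝ≥0) T → ℝ) (A : Integrator T) : ℝ :=
  ∫ᵛ t, f t ∂<•(A.boundedVariation.vectorMeasure)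

/-- The convergence generating the `S` topology on `D([0,∞))`: for every `T > 0`, one has
`∫₀ᵀ xₙ dAₙ → ∫₀ᵀ x₀ dA₀` whenever `Aₙ → A₀` in `𝔸([0,T])`. -/
def SConverges (x : ℕ → SkorokhodSpace) (x₀ : SkorokhodSpace) : Prop :=
  ∀ T : ℝ≥0, 0 < T → ∀ (A : ℕ → Integrator T) (A₀ : Integrator T), TauConverges A A₀ →
    Tendsto (fun n => stieltjesIntegral ((x n).restrict T) (A n)) atTop
      (𝓝 (stieltjesIntegral (x₀.restrict T) A₀))

/-- Every sequence in `K` has a subsequence which converges to some element of `D([0,∞))`. -/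
def IsRelativelySeqCompact (K : Set SkorokhodSpace) : Prop :=
  ∀ x : ℕ → SkorokhodSpace, (∀ n, x n ∈ K) →
    ∃ φ : ℕ → ℕ, StrictMono φ ∧ ∃ x₀ : SkorokhodSpace, SConverges (x ∘ φ) x₀

/-- Uniform boundedness of `K` on every `[0,T]`. -/
def UniformlyBounded (K : Set SkorokhodSpace) : Prop :=
  ∀ T : ℝ≥0, 0 < T → (⨆ x ∈ K, supNorm (x.restrict T)) < ∞

/-- Uniform boundedness over `K` of the numbers of up-crossings on every `[0,T]`. -/
def UniformlyBoundedUpcrossings (K : Set SkorokhodSpace) : Prop :=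
  ∀ T : ℝ≥0, 0 < T → ∀ a b : ℝ, a < b → (⨆ x ∈ K, upcrossingNumber a b (x.restrict T)) < ⊤

/-- Uniform boundedness over `K` of the numbers of `η`-oscillations on every `[0,T]`. -/
def UniformlyBoundedOscillations (K : Set SkorokhodSpace) : Prop :=
  ∀ T : ℝ≥0, 0 < T → ∀ η : ℝ, 0 < η → (⨆ x ∈ K, oscillationNumber η (x.restrict T)) < ⊤

end STopology

end

/-! Sufficiency of the oscillation bounds. Tychonoff over the nonnegative rationals gives a
subsequence converging pointwise there to some `y`. Chains of oscillations pass to pointwise limits,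
so `y` has one-sided limits, and its right limits define `x₀` in the Skorokhod space. Pointwise
convergence to `x₀` can fail, so the integrals are compared through `abs_integral_sub_le`: if a path
bounded by `C` has no `M + 1` successive `η`-oscillations, and the tails of `p` and `q` differ by at
most `β`, then the integrals differ by at most `2η` times the total mass plus `(M + 1) * 2Cβ`. This
permits replacing `dAₙ` by the image of `dA₀` under a small shift `up m` to the right onto rational
points. For fixed `m`, dominated convergence replaces `xₙ` by `y` as `n → ∞`; then `y (up m t) → x₀
t` as `m → ∞`.

Necessity. If a bound fails, there are signed combinations of point evaluations with total weight at
most 2 and distribution functions tending uniformly to 0, whose values on paths of `K` stay at least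
`c > 0`. By right continuity, narrow ramps imitate the point masses, giving integrators that
converge to 0 while the integrals stay at least `c / 2`. No subsequence can then converge.

The two crossing conditions are equivalent for bounded sets by pigeonhole: each large oscillation
crosses a cell of a fixed finite grid of levels, upwards or downwards. -/

namespace STopology

noncomputable section

/-! ### Integrators as differences of finite measures -/

namespace Integrator

variable {T : ℝ≥0}

/-- The left endpoint of `[0,T]`. -/
def left (T : ℝ≥0) : Icc (0 : ℝ≥0) T := ⟨0, left_mem_Icc.2 zero_le⟩

/-- The right endpoint of `[0,T]`. -/
def right (T : ℝ≥0) : Icc (0 : ℝ≥0) T := ⟨T, right_mem_Icc.2 zero_le⟩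

lemma left_le (t : Icc (0 : ℝ≥0) T) : left T ≤ t := t.2.1

lemma le_right (t : Icc (0 : ℝ≥0) T) : t ≤ right T := t.2.2

lemma isBot_left : IsBot (left T) := left_le

lemma Iic_eq_Icc (t : Icc (0 : ℝ≥0) T) : Iic t = Icc (left T) t := by
  ext s; simp [left_le]

lemma Iic_right : Iic (right T) = univ := by
  ext s; simp [le_right]

lemma vectorMeasure_Icc (A : Integrator T) {s t : Icc (0 : ℝ≥0) T} (h : s ≤ t) :
    A.boundedVariation.vectorMeasure (Icc s t) = A.toFun t - A.toFun s := by
  rw [BoundedVariationOn.vectorMeasure_Icc _ h,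
    ContinuousWithinAt.rightLim_eq A.continuous.continuousWithinAt,
    ContinuousWithinAt.leftLim_eq A.continuous.continuousWithinAt]

lemma vectorMeasure_Iic (A : Integrator T) (t : Icc (0 : ℝ≥0) T) :
    A.boundedVariation.vectorMeasure (Iic t) = A.toFun t := by
  rw [Iic_eq_Icc, A.vectorMeasure_Icc (left_le t)]
  simp [left, A.map_zero]

/-- The Stieltjes measure of an integrator is determined by its distribution function. -/
lemma vectorMeasure_eq (A : Integrator T) (μ : SignedMeasure (Icc (0 : ℝ≥0) T))
    (h : ∀ t, A.toFun t = μ (Iic t)) : A.boundedVariation.vectorMeasure = μ := by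
  have key : ∀ t, A.boundedVariation.vectorMeasure (Iic t) = μ (Iic t) := fun t => by
    rw [vectorMeasure_Iic, h]
  refine VectorMeasure.ext_of_generateFrom (range Iic) ?_ ?_ isPiSystem_Iic ?_
  · rintro _ ⟨t, rfl⟩
    exact key t
  · rw [← borel_eq_generateFrom_Iic]
    exact BorelSpace.measurable_eq
  · rw [← Iic_right]
    exact key _

lemma vectorMeasure_eq_sub (A : Integrator T) (p q : Measure (Icc (0 : ℝ≥0) T))
    [IsFiniteMeasure p] [IsFiniteMeasure q]
    (h : ∀ t, A.toFun t = p.real (Iic t) - q.real (Iic t)) :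
    A.boundedVariation.vectorMeasure = p.toSignedMeasure - q.toSignedMeasure :=
  A.vectorMeasure_eq _ fun t => by
    rw [h, Measure.toSignedMeasure_sub_apply measurableSet_Iic]

/-- The Stieltjes integral in terms of a representation of the integrator as a difference of
distribution functions. -/
lemma stieltjesIntegral_eq_sub (A : Integrator T) (p q : Measure (Icc (0 : ℝ≥0) T))
    [IsFiniteMeasure p] [IsFiniteMeasure q]
    (h : ∀ t, A.toFun t = p.real (Iic t) - q.real (Iic t))
    {f : Icc (0 : ℝ≥0) T → ℝ} (hp : Integrable f p) (hq : Integrable f q) :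
    stieltjesIntegral f A = ∫ t, f t ∂p - ∫ t, f t ∂q := by
  rw [stieltjesIntegral, A.vectorMeasure_eq_sub p q h, VectorMeasure.integral_sub_vectorMeasure,
    VectorMeasure.integral_toSignedMeasure, VectorMeasure.integral_toSignedMeasure]
  · simpa [VectorMeasure.Integrable] using hp
  · simpa [VectorMeasure.Integrable] using hq

/-- The Stieltjes measure puts no atom at the least point, so only the mass of the half-open
interval remains. -/
lemma _root_.StieltjesFunction.measure_Iic_of_left (F : StieltjesFunction (Icc (0 : ℝ≥0) T))
    (t : Icc (0 : ℝ≥0) T) : F.measure (Iic t) = ENNReal.ofReal (F t - F (left T)) := by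
  have h0 : F.measure {left T} = 0 := by
    rw [← botSet_eq_singleton_of_isBot isBot_left, F.measure_botSet]
  rw [← F.measure_Ioc, Iic_eq_Icc, ← Icc_union_Ioc_eq_Icc le_rfl (left_le t), Icc_self]
  refine le_antisymm ((measure_union_le _ _).trans (by simp [h0])) (measure_mono subset_union_right)

lemma _root_.StieltjesFunction.real_measure_Iic_of_left
    (F : StieltjesFunction (Icc (0 : ℝ≥0) T))
    (t : Icc (0 : ℝ≥0) T) : F.measure.real (Iic t) = F t - F (left T) := by
  rw [Measure.real, F.measure_Iic_of_left, ENNReal.toReal_ofReal]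
  exact sub_nonneg.2 (F.mono (left_le t))

lemma _root_.StieltjesFunction.isFiniteMeasure_of_Icc
    (F : StieltjesFunction (Icc (0 : ℝ≥0) T)) : IsFiniteMeasure F.measure :=
  ⟨by rw [← Iic_right, F.measure_Iic_of_left]; exact ENNReal.ofReal_lt_top⟩

/-- The total variation of an integrator, as a real number. -/
def var (A : Integrator T) : ℝ := (eVariationOn A.toFun univ).toReal

lemma var_nonneg (A : Integrator T) : 0 ≤ A.var := ENNReal.toReal_nonneg

/-- Jordan decomposition: with `V` the variation function, take the measures of `V` and `V - A`.
Their masses are `V(T)` and `V(T) - A(T)`, whence the factor 3. -/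
lemma exists_measure_Icc (A : Integrator T) : ∃ p q : Measure (Icc (0 : ℝ≥0) T),
    IsFiniteMeasure p ∧ IsFiniteMeasure q ∧ p.real univ + q.real univ ≤ 3 * A.var ∧
    ∀ t, A.toFun t = p.real (Iic t) - q.real (Iic t) := by
  have hA := A.boundedVariation
  have hV := hA.locallyBoundedVariationOn
  have hc : ∀ x, ContinuousWithinAt (variationOnFromTo A.toFun univ (left T)) (Ici x) x := fun x =>
    hA.continuousWithinAt_variationOnFromTo_Ici A.continuous.continuousWithinAt
  let P : StieltjesFunction (Icc (0 : ℝ≥0) T) :=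
    ⟨variationOnFromTo A.toFun univ (left T),
      monotoneOn_univ.1 (variationOnFromTo.monotoneOn hV (mem_univ _)), hc⟩
  let Q : StieltjesFunction (Icc (0 : ℝ≥0) T) :=
    ⟨variationOnFromTo A.toFun univ (left T) - A.toFun,
      monotoneOn_univ.1 (variationOnFromTo.sub_self_monotoneOn hV (mem_univ _)),
      fun x => (hc x).sub A.continuous.continuousWithinAt⟩
  have hP0 : P (left T) = 0 := variationOnFromTo.self _ _ _
  have hA0 : A.toFun (left T) = 0 := A.map_zero
  have hQ : ∀ t, Q t = P t - A.toFun t := fun t => rfl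
  refine ⟨P.measure, Q.measure, P.isFiniteMeasure_of_Icc, Q.isFiniteMeasure_of_Icc, ?_, ?_⟩
  · rw [← Iic_right, P.real_measure_Iic_of_left, Q.real_measure_Iic_of_left, hQ, hQ, hP0, hA0]
    have h1 : |P (right T)| ≤ A.var := variationOnFromTo.abs_le_eVariationOn hA
    have h2 : A.toFun (left T) - A.toFun (right T) ≤ A.var :=
      hA.sub_le (mem_univ _) (mem_univ _)
    have := abs_le.1 h1
    linarith
  · intro t
    rw [P.real_measure_Iic_of_left, Q.real_measure_Iic_of_left, hQ, hQ, hP0, hA0]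
    ring

/-- The extension of an integrator to `[0,∞)` that is constant on `[T,∞)`. -/
def extend (A : Integrator T) : ℝ≥0 → ℝ := IccExtend (zero_le : 0 ≤ T) A.toFun

/-- An integrator is the difference of the distribution functions of two finite measures, whose
masses are controlled by its variation. -/
lemma exists_measure (A : Integrator T) : ∃ p q : Measure ℝ≥0,
    IsFiniteMeasure p ∧ IsFiniteMeasure q ∧ p (Ioi T) = 0 ∧ q (Ioi T) = 0 ∧
    p.real univ + q.real univ ≤ 3 * A.var ∧
    (∀ s, p.real (Ici s) - q.real (Ici s) = A.extend T - A.extend s) ∧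
    ∀ (f : ℝ≥0 → ℝ) (C : ℝ), Measurable f → (∀ t ≤ T, |f t| ≤ C) →
      stieltjesIntegral (fun t : Icc (0 : ℝ≥0) T => f t) A = ∫ t, f t ∂p - ∫ t, f t ∂q := by
  obtain ⟨p, q, hp, hq, hm, h⟩ := A.exists_measure_Icc
  have mc : Measurable (Subtype.val : Icc (0 : ℝ≥0) T → ℝ≥0) := measurable_subtype_coe
  have hr : ∀ (m : Measure (Icc (0 : ℝ≥0) T)) {s}, MeasurableSet s →
      (m.map Subtype.val).real s = m.real (Subtype.val ⁻¹' s) := fun m s hs => by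
    rw [Measure.real, Measure.map_apply mc hs, Measure.real]
  have hT : (Subtype.val ⁻¹' Ioi T : Set (Icc (0 : ℝ≥0) T)) = ∅ := by
    ext t; simpa using t.2.2
  -- Passing to `[0,∞)` leaves room for the shift `up m`, which may carry mass beyond `T`.
  refine ⟨p.map Subtype.val, q.map Subtype.val, inferInstance, inferInstance, ?_, ?_, ?_, ?_, ?_⟩
  · rw [Measure.map_apply mc measurableSet_Ioi, hT, measure_empty]
  · rw [Measure.map_apply mc measurableSet_Ioi, hT, measure_empty]
  · simpa [hr] using hm
  · intro s
    rw [hr _ measurableSet_Ici, hr _ measurableSet_Ici]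
    rcases le_or_gt s T with hs | hs
    · have e : (Subtype.val ⁻¹' Ici s : Set (Icc (0 : ℝ≥0) T)) =
          Icc ⟨s, zero_le, hs⟩ (right T) := by
        exact Set.ext fun t => ⟨fun ht => ⟨ht, le_right t⟩, fun ht => ht.1⟩
      have := A.vectorMeasure_Icc (le_right ⟨s, zero_le, hs⟩)
      rw [A.vectorMeasure_eq_sub p q h, Measure.toSignedMeasure_sub_apply measurableSet_Icc] at this
      rw [e, this, extend, IccExtend_of_mem _ _ (⟨zero_le, hs⟩ : s ∈ Icc 0 T),
        IccExtend_of_mem _ _ (right_mem_Icc.2 zero_le : T ∈ Icc 0 T)]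
      rfl
    · have e : (Subtype.val ⁻¹' Ici s : Set (Icc (0 : ℝ≥0) T)) = ∅ := by
        ext t; simpa using t.2.2.trans_lt hs
      rw [e, extend, IccExtend_of_right_le _ _ hs.le, IccExtend_of_right_le _ _ le_rfl]
      simp
  · intro f C hf hC
    have hi : ∀ m : Measure (Icc (0 : ℝ≥0) T), IsFiniteMeasure m →
        Integrable (fun t : Icc (0 : ℝ≥0) T => f t) m := fun m _ =>
      Integrable.of_bound (hf.comp mc).aestronglyMeasurable C
        (Eventually.of_forall fun t => hC t t.2.2)
    rw [A.stieltjesIntegral_eq_sub p q h (hi p hp) (hi q hq),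
      integral_map mc.aemeasurable hf.aestronglyMeasurable,
      integral_map mc.aemeasurable hf.aestronglyMeasurable]

end Integrator

end


/-! ### Chains of oscillations -/

section Chains

variable {α β : Type*} [LinearOrder α] [LinearOrder β] {η : ℝ}

/-- There is a chain of `k` successive `η`-oscillations of `f` to the right of the given point. -/
def OscChain (η : ℝ) (f : α → ℝ) : ℕ → α → Prop
  | 0, _ => True
  | k + 1, s => ∃ u v, s ≤ u ∧ u < v ∧ η < |f v - f u| ∧ OscChain η f k v

lemma OscChain.anti {f : α → ℝ} {k : ℕ} {s s' : α} (h : OscChain η f k s) (hs : s' ≤ s) :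
    OscChain η f k s' := by
  cases k with
  | zero => trivial
  | succ k =>
    obtain ⟨u, v, h1, h2⟩ := h
    exact ⟨u, v, hs.trans h1, h2⟩

/-- Strictness survives a merely monotone map, since values at equal points cannot differ by more
than `η ≥ 0`. It serves both for stopping a path and for restricting it to the rationals. -/
lemma OscChain.of_comp {f : β → ℝ} {r : α → β} (hr : Monotone r) (hη : 0 ≤ η) {k : ℕ} {s : α}
    (h : OscChain η (f ∘ r) k s) : OscChain η f k (r s) := by
  induction k generalizing s with
  | zero => trivial
  | succ k ih =>
    obtain ⟨u, v, h1, h2, h3, h4⟩ := h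
    refine ⟨r u, r v, hr h1, (hr h2.le).lt_of_ne fun e => ?_, h3, ih h4⟩
    simp only [Function.comp_apply, e, sub_self, abs_zero] at h3
    exact h3.not_ge hη

/-- A chain consists of finitely many strict inequalities between values, an open condition under
pointwise convergence. -/
lemma OscChain.eventually {f : ℕ → α → ℝ} {g : α → ℝ}
    (hf : ∀ t, Tendsto (fun n => f n t) atTop (𝓝 (g t))) {k : ℕ} {s : α} (h : OscChain η g k s) :
    ∀ᶠ n in atTop, OscChain η (f n) k s := by
  induction k generalizing s with
  | zero => exact Eventually.of_forall fun _ => trivial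
  | succ k ih =>
    obtain ⟨u, v, h1, h2, h3, h4⟩ := h
    filter_upwards [ih h4, (((hf v).sub (hf u)).abs).eventually_const_lt h3] with n h5 h6
    exact ⟨u, v, h1, h2, h6, h5⟩

lemma OscChain.exists_fin {f : α → ℝ} {k : ℕ} {a : α} (h : OscChain η f k a) :
    ∃ s t : Fin k → α, (∀ i, a ≤ s i) ∧ (∀ i, s i < t i) ∧ (∀ i j, i < j → t i ≤ s j) ∧
      ∀ i, η < |f (t i) - f (s i)| := by
  induction k generalizing a with
  | zero => exact ⟨Fin.elim0, Fin.elim0, fun i => i.elim0, fun i => i.elim0, fun i => i.elim0,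
      fun i => i.elim0⟩
  | succ k ih =>
    obtain ⟨u, v, h1, h2, h3, h4⟩ := h
    obtain ⟨s, t, i1, i2, i3, i4⟩ := ih h4
    refine ⟨Fin.cons u s, Fin.cons v t, ?_, ?_, ?_, ?_⟩
    · intro i
      refine Fin.cases ?_ (fun i => ?_) i
      · simpa using h1
      · simpa using (h1.trans h2.le).trans (i1 i)
    · intro i
      refine Fin.cases ?_ (fun i => ?_) i
      · simpa using h2
      · simpa using i2 i
    · intro i j hij
      induction j using Fin.cases with
      | zero => exact absurd hij (Fin.not_lt_zero _)
      | succ j =>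
        induction i using Fin.cases with
        | zero => simpa using i1 j
        | succ i => simpa using i3 i j (Fin.succ_lt_succ_iff.1 hij)
    · intro i
      refine Fin.cases ?_ (fun i => ?_) i
      · simpa using h3
      · simpa using i4 i

lemma OscChain.le_oscillationNumber {f : α → ℝ} {k : ℕ} {a : α} (h : OscChain η f k a) :
    (k : ℕ∞) ≤ oscillationNumber η f := by
  obtain ⟨s, t, -, h1, h2, h3⟩ := h.exists_fin
  exact le_iSup₂_of_le k ⟨s, t, h1, h2, h3⟩ le_rfl

/-- A function without long chains of oscillations has a limit along every filter that contains
no chains of oscillations. -/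
lemma exists_tendsto_of_oscillation {f : α → ℝ} {F : Filter α} [F.NeBot]
    (h : ∀ η > 0, ∃ S ∈ F, ∀ u ∈ S, ∀ v ∈ S, u < v → |f v - f u| ≤ η) :
    ∃ l, Tendsto f F (𝓝 l) := by
  have hc : Cauchy (map f F) := by
    refine Metric.cauchy_iff.2 ⟨inferInstance, fun ε hε => ?_⟩
    obtain ⟨S, hS, h⟩ := h (ε / 2) (half_pos hε)
    refine ⟨f '' S, image_mem_map hS, ?_⟩
    rintro _ ⟨u, hu, rfl⟩ _ ⟨v, hv, rfl⟩
    rw [Real.dist_eq]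
    rcases lt_trichotomy u v with huv | rfl | huv
    · rw [abs_sub_comm]; linarith [h u hu v hv huv]
    · simpa using hε
    · linarith [h v hv u hu huv]
  exact cauchy_map_iff_exists_tendsto.1 hc

end Chains

/-! ### Rational approximation from the right -/

section Approx

/-- The approximation of `t` from the right by a rational number with denominator `m + 1`. -/
noncomputable def up (m : ℕ) (t : ℝ≥0) : ℚ≥0 := ((⌊(m + 1) * t⌋₊ + 1 : ℕ) : ℚ≥0) / (m + 1)

lemma coe_up (m : ℕ) (t : ℝ≥0) : ((up m t : ℚ≥0) : ℝ≥0) = (⌊(m + 1) * t⌋₊ + 1) / (m + 1) := by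
  simp [up]

lemma lt_up (m : ℕ) (t : ℝ≥0) : t < (up m t : ℝ≥0) := by
  rw [coe_up, lt_div_iff₀ (by positivity), mul_comm]
  exact Nat.lt_floor_add_one _

lemma up_le (m : ℕ) (t : ℝ≥0) : (up m t : ℝ≥0) ≤ t + 1 / (m + 1) := by
  have h : (1 : ℝ≥0) / (m + 1) * (m + 1) = 1 := div_mul_cancel₀ _ (by positivity)
  rw [coe_up, div_le_iff₀ (by positivity), add_mul t, h, mul_comm t]
  gcongr
  exact Nat.floor_le (by positivity)

/-- The smallest `t` with `s ≤ up m t`. -/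
noncomputable def down (m : ℕ) (s : ℝ≥0) : ℝ≥0 := ((⌈(m + 1) * s⌉₊ - 1 : ℕ) : ℝ≥0) / (m + 1)

/-- This adjunction computes tails of image measures: the preimage of `Ici s` under `up m` is `Ici
(down m s)`. At `s = 0` the truncated subtraction correctly yields 0. -/
lemma le_up_iff (m : ℕ) (s t : ℝ≥0) : s ≤ (up m t : ℝ≥0) ↔ down m s ≤ t := by
  have h : (((⌊(m + 1) * t⌋₊ + 1 : ℕ) : ℝ≥0)) = ⌊(m + 1) * t⌋₊ + 1 := by push_cast; rfl
  rw [coe_up, le_div_iff₀ (by positivity), down, div_le_iff₀ (by positivity), mul_comm s,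
    mul_comm t, ← h, ← Nat.ceil_le, ← Nat.le_floor_iff (by positivity)]
  omega

lemma down_le (m : ℕ) (s : ℝ≥0) : down m s ≤ s := (le_up_iff m s s).1 (lt_up m s).le

lemma le_down_add (m : ℕ) (s : ℝ≥0) : s ≤ down m s + 1 / (m + 1) :=
  ((le_up_iff m s _).2 le_rfl).trans (up_le m _)

lemma tendsto_up (t : ℝ≥0) : Tendsto (fun m => ((up m t : ℚ≥0) : ℝ≥0)) atTop (𝓝[>] t) := by
  refine tendsto_nhdsWithin_iff.2 ⟨?_, Eventually.of_forall fun m => lt_up m t⟩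
  have h : Tendsto (fun m : ℕ => t + 1 / ((m : ℝ≥0) + 1)) atTop (𝓝 t) := by
    simpa using tendsto_const_nhds.add (tendsto_one_div_add_atTop_nhds_zero_nat (𝕜 := ℝ≥0))
  exact tendsto_of_tendsto_of_tendsto_of_le_of_le tendsto_const_nhds h (fun m => (lt_up m t).le)
    (fun m => up_le m t)

lemma measurable_comp_up (m : ℕ) (f : ℚ≥0 → ℝ) : Measurable (fun t => f (up m t)) := by
  have h : Measurable fun t : ℝ≥0 => ⌊(m + 1) * t⌋₊ := Nat.measurable_floor.comp (by fun_prop)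
  exact (measurable_from_nat (f := fun k : ℕ => f (((k + 1 : ℕ) : ℚ≥0) / (m + 1)))).comp h

lemma measurable_up (m : ℕ) : Measurable (fun t => ((up m t : ℚ≥0) : ℝ≥0)) := by
  have h : Measurable fun t : ℝ≥0 => ⌊(m + 1) * t⌋₊ := Nat.measurable_floor.comp (by fun_prop)
  exact (measurable_from_nat
    (f := fun k : ℕ => (((((k + 1 : ℕ) : ℚ≥0) / (m + 1)) : ℚ≥0) : ℝ≥0))).comp h

lemma measurable_of_right_continuous {x : ℝ≥0 → ℝ}
    (hx : ∀ t, ContinuousWithinAt x (Ici t) t) : Measurable x := by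
  refine measurable_of_tendsto_metrizable (f := fun m t => x (up m t))
    (fun m => measurable_comp_up m fun q => x q) ?_
  refine tendsto_pi_nhds.2 fun t => ?_
  exact ((hx t).mono Ioi_subset_Ici_self).tendsto.comp (tendsto_up t)

end Approx

/-! ### The integral estimate for paths with few oscillations -/

section Key

variable {x : ℝ≥0 → ℝ} {η C β : ℝ} {p q : Measure ℝ≥0} [IsFiniteMeasure p] [IsFiniteMeasure q]

/-- Replacing `x` by the constant `c` costs `η` times the masses; the constant itself contributes at
most `C * β`. -/
lemma abs_setIntegral_sub_le {S : Set ℝ≥0} (hm : Measurable x)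
    (hC : ∀ t, |x t| ≤ C) {c : ℝ} (hc : |c| ≤ C) (h : ∀ t ∈ S, |x t - c| ≤ η)
    (hβ : |p.real S - q.real S| ≤ β) :
    |∫ t in S, x t ∂p - ∫ t in S, x t ∂q| ≤ η * (p.real S + q.real S) + C * β := by
  have key : ∀ (m : Measure ℝ≥0) [IsFiniteMeasure m],
      |∫ t in S, x t ∂m - c * m.real S| ≤ η * m.real S := by
    intro m _
    have hi : Integrable x (m.restrict S) :=
      Integrable.of_bound hm.aestronglyMeasurable C (Eventually.of_forall hC)
    have h1 : ∫ t in S, x t ∂m - c * m.real S = ∫ t in S, (x t - c) ∂m := by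
      rw [integral_sub hi (integrable_const _), setIntegral_const, smul_eq_mul, mul_comm c]
    rw [h1, ← Real.norm_eq_abs]
    exact norm_setIntegral_le_of_norm_le_const (measure_lt_top _ _) h
  have h1 := abs_le.1 (key p)
  have h2 := abs_le.1 (key q)
  have h3 : |c * (p.real S - q.real S)| ≤ C * β := by
    rw [abs_mul]
    exact mul_le_mul hc hβ (abs_nonneg _) ((abs_nonneg _).trans hc)
  have h4 := abs_le.1 h3
  rw [abs_le]
  constructor <;> nlinarith

/-- The first time at which a right-continuous function has moved by more than `η`. -/
lemma exists_first_oscillation (hx : ∀ t, ContinuousWithinAt x (Ici t) t) (hη : 0 < η) (s : ℝ≥0) :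
    (∀ t, s ≤ t → |x t - x s| ≤ η) ∨
      ∃ s', s < s' ∧ η ≤ |x s' - x s| ∧ ∀ t ∈ Ico s s', |x t - x s| ≤ η := by
  by_cases hJ : ∀ t, s ≤ t → |x t - x s| ≤ η
  · exact Or.inl hJ
  push Not at hJ
  right
  let J := {t | s ≤ t ∧ η < |x t - x s|}
  have hne : J.Nonempty := hJ
  have hbdd : BddBelow J := OrderBot.bddBelow J
  have hle : s ≤ sInf J := le_csInf hne fun t ht => ht.1
  have hge : η ≤ |x (sInf J) - x s| := by
    have hn : (𝓝[J] sInf J).NeBot := mem_closure_iff_nhdsWithin_neBot.1 (csInf_mem_closure hne hbdd)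
    have ht : Tendsto x (𝓝[J] sInf J) (𝓝 (x (sInf J))) :=
      (hx (sInf J)).mono fun t ht => csInf_le hbdd ht
    exact ge_of_tendsto (ht.sub_const _).abs
      (eventually_mem_nhdsWithin.mono fun t ht => ht.2.le)
  refine ⟨sInf J, hle.lt_of_ne fun e => ?_, hge, fun t ht => ?_⟩
  · rw [← e, sub_self, abs_zero] at hge
    exact hge.not_gt hη
  · by_contra hlt
    exact (csInf_le hbdd (⟨ht.1, not_le.1 hlt⟩ : t ∈ J)).not_gt ht.2

/-- Cut at the first time `s'` at which `x` has moved by `2η`. The infimum gives only a weak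
inequality, so `2η` is used to secure a strict `η`-oscillation, which leaves one fewer for `Ici s'`.
On `Ico s s'` the measures differ by a difference of two tails, hence by at most `2β`. -/
lemma abs_integral_Ici_sub_le (hx : ∀ t, ContinuousWithinAt x (Ici t) t)
    (hC : ∀ t, |x t| ≤ C) (hη : 0 < η)
    (hβ : ∀ s, |p.real (Ici s) - q.real (Ici s)| ≤ β) (M : ℕ) (s : ℝ≥0)
    (h : ¬ OscChain η x (M + 1) s) :
    |∫ t in Ici s, x t ∂p - ∫ t in Ici s, x t ∂q| ≤
      2 * η * (p.real (Ici s) + q.real (Ici s)) + (M + 1) * (2 * C * β) := by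
  have hm := measurable_of_right_continuous hx
  have hC0 : 0 ≤ C := (abs_nonneg _).trans (hC 0)
  have hβ0 : 0 ≤ β := (abs_nonneg _).trans (hβ 0)
  have hCβ : 0 ≤ C * β := mul_nonneg hC0 hβ0
  induction M generalizing s with
  | zero =>
    rcases exists_first_oscillation hx (mul_pos two_pos hη) s with h1 | ⟨s', h1, h2, -⟩
    · have := abs_setIntegral_sub_le (S := Ici s) (p := p) (q := q) hm hC (hC s) h1 (hβ s)
      push_cast
      linarith
    · exact absurd ⟨s, s', le_rfl, h1, by linarith, trivial⟩ h
  | succ M ih =>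
    rcases exists_first_oscillation hx (mul_pos two_pos hη) s with h1 | ⟨s', h1, h2, h3⟩
    · have := abs_setIntegral_sub_le (S := Ici s) (p := p) (q := q) hm hC (hC s) h1 (hβ s)
      have h4 : 0 ≤ (M : ℝ) * (C * β) := by positivity
      push_cast
      nlinarith
    · have h4 : ¬ OscChain η x (M + 1) s' := fun h4 =>
        h ⟨s, s', le_rfl, h1, by linarith, h4⟩
      have h5 := ih s' h4
      have hd : Disjoint (Ico s s') (Ici s') :=
        Set.disjoint_left.2 fun t ht ht' => ht.2.not_ge ht'
      have hu : Ico s s' ∪ Ici s' = Ici s := Ico_union_Ici_eq_Ici h1.le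
      have hr : ∀ (m : Measure ℝ≥0) [IsFiniteMeasure m],
          m.real (Ici s) = m.real (Ico s s') + m.real (Ici s') := fun m _ => by
        rw [← hu, measureReal_union hd measurableSet_Ici]
      have hI : ∀ (m : Measure ℝ≥0) [IsFiniteMeasure m], ∫ t in Ici s, x t ∂m =
          ∫ t in Ico s s', x t ∂m + ∫ t in Ici s', x t ∂m := fun m _ => by
        have hi : Integrable x m :=
          Integrable.of_bound hm.aestronglyMeasurable C (Eventually.of_forall hC)
        rw [← hu, setIntegral_union hd measurableSet_Ici hi.integrableOn hi.integrableOn]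
      have hβ' : |p.real (Ico s s') - q.real (Ico s s')| ≤ 2 * β := by
        have e : p.real (Ico s s') - q.real (Ico s s') =
            (p.real (Ici s) - q.real (Ici s)) - (p.real (Ici s') - q.real (Ici s')) := by
          rw [hr p, hr q]; ring
        rw [e]
        exact (abs_sub _ _).trans (by linarith [hβ s, hβ s'])
      have h6 := abs_setIntegral_sub_le (p := p) (q := q) hm hC (hC s) h3 hβ'
      rw [hI p, hI q, hr p, hr q]
      have h7 : ∀ a b c d : ℝ, |a + b - (c + d)| ≤ |a - c| + |b - d| := fun a b c d => by
        rw [add_sub_add_comm]; exact abs_add_le _ _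
      refine (h7 _ _ _ _).trans ?_
      push_cast
      linarith

/-- The integral of a function with few oscillations depends continuously, in the sense of uniform
convergence of distribution functions, on the integrator. -/
lemma abs_integral_sub_le (hx : ∀ t, ContinuousWithinAt x (Ici t) t)
    (hC : ∀ t, |x t| ≤ C) (hη : 0 < η)
    (hβ : ∀ s, |p.real (Ici s) - q.real (Ici s)| ≤ β) (M : ℕ) (h : ¬ OscChain η x (M + 1) 0) :
    |∫ t, x t ∂p - ∫ t, x t ∂q| ≤
      2 * η * (p.real univ + q.real univ) + (M + 1) * (2 * C * β) := by
  have e : (Ici 0 : Set ℝ≥0) = univ := by ext; simp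
  simpa [e] using abs_integral_Ici_sub_le hx hC hη hβ M 0 h

end Key


/-! ### One-sided limits along the rationals -/

section Limits

variable {y : ℚ≥0 → ℝ}

lemma exists_nnrat_between {s t : ℝ≥0} (h : s < t) : ∃ q : ℚ≥0, s < q ∧ (q : ℝ≥0) < t := by
  have h1 := (tendsto_nhdsWithin_iff.1 (tendsto_up s)).1.eventually_lt_const h
  obtain ⟨m, hm⟩ := h1.exists
  exact ⟨up m s, lt_up m s, hm⟩

lemma comap_nhdsGT_neBot (t : ℝ≥0) : (comap ((↑) : ℚ≥0 → ℝ≥0) (𝓝[>] t)).NeBot := by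
  refine comap_neBot_iff.2 fun S hS => ?_
  obtain ⟨m, hm⟩ := ((tendsto_up t).eventually hS).exists
  exact ⟨_, hm⟩

lemma comap_nhdsLT_neBot {t : ℝ≥0} (ht : 0 < t) :
    (comap ((↑) : ℚ≥0 → ℝ≥0) (𝓝[<] t)).NeBot := by
  refine comap_neBot_iff.2 fun S hS => ?_
  obtain ⟨a, ha, hS⟩ := (mem_nhdsLT_iff_exists_Ioo_subset' ht).1 hS
  obtain ⟨q, h1, h2⟩ := exists_nnrat_between ha
  exact ⟨q, hS ⟨h1, h2⟩⟩

lemma tendsto_up_comap (t : ℝ≥0) :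
    Tendsto (fun m => up m t) atTop (comap ((↑) : ℚ≥0 → ℝ≥0) (𝓝[>] t)) :=
  tendsto_comap_iff.2 (tendsto_up t)

/-- Otherwise a chain could be prolonged indefinitely at its front, by oscillations ever closer to
`t`. -/
lemma exists_right_limit (h : ∀ η > 0, ∃ k, ∀ s, ¬ OscChain η y k s) (t : ℝ≥0) :
    ∃ l, Tendsto y (comap (↑) (𝓝[>] t)) (𝓝 l) := by
  have := comap_nhdsGT_neBot t
  refine exists_tendsto_of_oscillation fun η hη => ?_
  by_contra! hc
  have key : ∀ k, ∃ v : ℚ≥0, t < (v : ℝ≥0) ∧ OscChain η y k v := by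
    intro k
    induction k with
    | zero => exact ⟨up 0 t, lt_up 0 t, trivial⟩
    | succ k ih =>
      obtain ⟨v, hv, hk⟩ := ih
      obtain ⟨a, ha, b, hb, hab, hη⟩ :=
        hc _ (preimage_mem_comap (m := ((↑) : ℚ≥0 → ℝ≥0)) (Ioo_mem_nhdsGT hv))
      exact ⟨a, ha.1, a, b, le_rfl, hab, hη, hk.anti (by exact_mod_cast hb.2.le)⟩
  obtain ⟨k, hk⟩ := h η hη
  obtain ⟨v, -, hv⟩ := key k
  exact hk v hv

/-- Otherwise every point left of `t` starts arbitrarily long chains, each oscillation being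
followed by another still left of `t`. -/
lemma exists_left_limit (h : ∀ η > 0, ∃ k, ∀ s, ¬ OscChain η y k s) {t : ℝ≥0} (ht : 0 < t) :
    ∃ l, Tendsto y (comap (↑) (𝓝[<] t)) (𝓝 l) := by
  have := comap_nhdsLT_neBot ht
  refine exists_tendsto_of_oscillation fun η hη => ?_
  by_contra! hc
  have key : ∀ k, ∀ w : ℚ≥0, (w : ℝ≥0) < t → OscChain η y k w := by
    intro k
    induction k with
    | zero => exact fun _ _ => trivial
    | succ k ih =>
      intro w hw
      obtain ⟨a, ha, b, hb, hab, hη⟩ :=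
        hc _ (preimage_mem_comap (m := ((↑) : ℚ≥0 → ℝ≥0)) (Ioo_mem_nhdsLT hw))
      exact ⟨a, b, by exact_mod_cast ha.1.le, hab, hη, ih b hb.2⟩
  obtain ⟨k, hk⟩ := h η hη
  exact hk 0 (key k 0 (by simpa using ht))

/-- Each `x s` is a limit of values of `y` at rationals just right of `s`; as `I` is open these
remain in `I`, so bounds on `y` pass to `x`. -/
lemma tendsto_of_right_limits {x : ℝ≥0 → ℝ}
    (h : ∀ s, Tendsto y (comap (↑) (𝓝[>] s)) (𝓝 (x s))) {I : Set ℝ≥0} (hI : IsOpen I) {t : ℝ≥0}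
    {l : ℝ} (hy : Tendsto y (comap (↑) (𝓝[I] t)) (𝓝 l)) : Tendsto x (𝓝[I] t) (𝓝 l) := by
  refine Metric.tendsto_nhds.2 fun ε hε => ?_
  have h1 := eventually_comap.1 (Metric.tendsto_nhds.1 hy (ε / 2) (half_pos hε))
  filter_upwards [eventually_eventually_nhdsWithin.2 h1, self_mem_nhdsWithin] with s hs hsI
  rw [hI.nhdsWithin_eq hsI] at hs
  have h2 : ∀ᶠ q in comap ((↑) : ℚ≥0 → ℝ≥0) (𝓝[>] s), dist (y q) l < ε / 2 :=
    eventually_comap.2 (hs.filter_mono nhdsWithin_le_nhds)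
  have := comap_nhdsGT_neBot s
  have h3 := le_of_tendsto ((h s).dist tendsto_const_nhds) (h2.mono fun q hq => hq.le)
  linarith

end Limits

/-! ### Stopped paths and convergence of the integrals -/

namespace SkorokhodSpace

/-- The path `x` stopped at time `N`. -/
def stopAt (x : SkorokhodSpace) (N : ℝ≥0) : ℝ≥0 → ℝ := fun t => x.1 (min t N)

lemma stopAt_of_le (x : SkorokhodSpace) {N t : ℝ≥0} (h : t ≤ N) : x.stopAt N t = x.1 t := by
  rw [stopAt, min_eq_left h]

lemma stopAt_continuousWithinAt (x : SkorokhodSpace) (N t : ℝ≥0) :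
    ContinuousWithinAt (x.stopAt N) (Ici t) t := by
  have h : ContinuousWithinAt (fun t : ℝ≥0 => min t N) (Ici t) t := by fun_prop
  exact ContinuousWithinAt.comp (f := fun t : ℝ≥0 => min t N) (g := x.1) (x.2.1 (min t N)) h
    fun s hs => min_le_min_right N hs

lemma stopAt_measurable (x : SkorokhodSpace) (N : ℝ≥0) : Measurable (x.stopAt N) :=
  measurable_of_right_continuous (x.stopAt_continuousWithinAt N)

end SkorokhodSpace

lemma UniformlyBounded.exists_bound {K : Set SkorokhodSpace} (h : UniformlyBounded K) {T : ℝ≥0}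
    (hT : 0 < T) : ∃ C : ℝ, ∀ x ∈ K, ∀ t ≤ T, |x.1 t| ≤ C := by
  refine ⟨(⨆ x ∈ K, supNorm (x.restrict T)).toReal, fun x hx t ht => ?_⟩
  have h1 : ‖x.1 t‖ₑ ≤ ⨆ x ∈ K, supNorm (x.restrict T) :=
    le_trans (le_iSup (fun s => ‖x.restrict T s‖ₑ) ⟨t, zero_le, ht⟩)
      (le_iSup₂_of_le x hx le_rfl)
  have h2 := ENNReal.toReal_mono (h T hT).ne h1
  simpa using h2

lemma UniformlyBoundedOscillations.exists_bound {K : Set SkorokhodSpace}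
    (h : UniformlyBoundedOscillations K) {T : ℝ≥0} (hT : 0 < T) {η : ℝ} (hη : 0 < η) :
    ∃ M : ℕ, ∀ x ∈ K, ∀ s, ¬ OscChain η (x.stopAt T) (M + 1) s := by
  obtain ⟨M, hM⟩ := WithTop.ne_top_iff_exists.1 (h T hT η hη).ne
  refine ⟨M, fun x hx s hs => ?_⟩
  let r : ℝ≥0 → Icc (0 : ℝ≥0) T := fun t => ⟨min t T, zero_le, min_le_right _ _⟩
  have hr : Monotone r := fun a b hab => Subtype.coe_le_coe.1 (min_le_min_right T hab)
  have h1 : OscChain η (x.restrict T) (M + 1) (r s) := OscChain.of_comp hr hη.le hs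
  have h2 : ((M + 1 : ℕ) : ℕ∞) ≤ M :=
    h1.le_oscillationNumber.trans ((le_iSup₂_of_le x hx le_rfl).trans hM.ge)
  exact absurd (Nat.cast_le.1 h2) (by omega)

section Convergence

variable {T : ℝ≥0}

lemma Integrator.extend_eq (A : Integrator T) (s : ℝ≥0) :
    A.extend s = A.toFun ⟨min s T, zero_le, min_le_right _ _⟩ := by
  simp [extend, IccExtend, projIcc, min_comm]

lemma Integrator.exists_extend_modulus (A : Integrator T) {ε : ℝ} (hε : 0 < ε) :
    ∃ δ > 0, ∀ s t : ℝ≥0, dist s t < δ → |A.extend s - A.extend t| < ε := by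
  have hu := CompactSpace.uniformContinuous_of_continuous A.continuous
  obtain ⟨δ, hδ, h⟩ := Metric.uniformContinuous_iff.1 hu ε hε
  refine ⟨δ, hδ, fun s t hst => ?_⟩
  rw [A.extend_eq, A.extend_eq, ← Real.dist_eq]
  refine h (lt_of_le_of_lt ?_ hst)
  rw [Subtype.dist_eq, NNReal.dist_eq, NNReal.dist_eq, NNReal.coe_min, NNReal.coe_min]
  exact abs_inf_sub_inf_le_abs _ _ _

/-- Regroup the four measures as `p` plus the image of `q₀` against `q` plus the image of `p₀`. The
total mass is at most `2 * V`, which turns `2 * η` into `4 * η * V`. -/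
lemma abs_sub_le_of_up {x : ℝ≥0 → ℝ} {η C β V : ℝ} {p q p₀ q₀ : Measure ℝ≥0}
    [IsFiniteMeasure p] [IsFiniteMeasure q] [IsFiniteMeasure p₀] [IsFiniteMeasure q₀]
    (hx : ∀ t, ContinuousWithinAt x (Ici t) t) (hC : ∀ t, |x t| ≤ C) (hη : 0 < η) (m : ℕ)
    (hβ : ∀ s, |(p.real (Ici s) - q.real (Ici s)) -
      (p₀.real (Ici (down m s)) - q₀.real (Ici (down m s)))| ≤ β)
    (hV : p.real univ + q.real univ ≤ V) (hV₀ : p₀.real univ + q₀.real univ ≤ V)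
    (M : ℕ) (h : ¬ OscChain η x (M + 1) 0) :
    |(∫ t, x t ∂p - ∫ t, x t ∂q) - (∫ t, x (up m t) ∂p₀ - ∫ t, x (up m t) ∂q₀)| ≤
      4 * η * V + (M + 1) * (2 * C * β) := by
  have hm := measurable_of_right_continuous hx
  have mu := measurable_up m
  have hi : ∀ (μ : Measure ℝ≥0) [IsFiniteMeasure μ], Integrable x μ := fun μ _ =>
    Integrable.of_bound hm.aestronglyMeasurable C (Eventually.of_forall hC)
  have hr : ∀ (μ : Measure ℝ≥0) [IsFiniteMeasure μ] s,
      (μ.map fun t => ((up m t : ℚ≥0) : ℝ≥0)).real (Ici s) = μ.real (Ici (down m s)) := by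
    intro μ _ s
    have : (fun t => ((up m t : ℚ≥0) : ℝ≥0)) ⁻¹' Ici s = Ici (down m s) := by
      ext t; exact le_up_iff m s t
    rw [Measure.real, Measure.map_apply mu measurableSet_Ici, this, Measure.real]
  have hru : ∀ (μ : Measure ℝ≥0) [IsFiniteMeasure μ],
      (μ.map fun t => ((up m t : ℚ≥0) : ℝ≥0)).real univ = μ.real univ := by
    intro μ _
    rw [Measure.real, Measure.map_apply mu MeasurableSet.univ, preimage_univ, Measure.real]
  have key := abs_integral_sub_le (x := x) (p := p + q₀.map fun t => ((up m t : ℚ≥0) : ℝ≥0))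
    (q := q + p₀.map fun t => ((up m t : ℚ≥0) : ℝ≥0)) (β := β) hx hC hη (fun s => by
      rw [measureReal_add_apply, measureReal_add_apply, hr, hr]
      convert hβ s using 2
      ring) M h
  rw [integral_add_measure (hi _) (hi _), integral_add_measure (hi _) (hi _),
    integral_map mu.aemeasurable hm.aestronglyMeasurable,
    integral_map mu.aemeasurable hm.aestronglyMeasurable, measureReal_add_apply,
    measureReal_add_apply, hru, hru] at key
  have e : (∫ t, x t ∂p - ∫ t, x t ∂q) - (∫ t, x (up m t) ∂p₀ - ∫ t, x (up m t) ∂q₀) =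
      ∫ t, x t ∂p + ∫ t, x (up m t) ∂q₀ - (∫ t, x t ∂q + ∫ t, x (up m t) ∂p₀) := by ring
  rw [e]
  nlinarith

lemma TauConverges.exists_var_le {A : ℕ → Integrator T} {A₀ : Integrator T}
    (h : TauConverges A A₀) : ∃ V, 0 ≤ V ∧ A₀.var ≤ V ∧ ∀ n, (A n).var ≤ V := by
  have hn : ∀ n, (A n).var ≤ (⨆ n, eVariationOn (A n).toFun univ).toReal := fun n =>
    ENNReal.toReal_mono h.2.ne (le_iSup (fun n => eVariationOn (A n).toFun univ) n)
  refine ⟨max A₀.var (⨆ n, eVariationOn (A n).toFun univ).toReal,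
    le_max_of_le_left A₀.var_nonneg, le_max_left _ _, fun n => (hn n).trans (le_max_right _ _)⟩

lemma TauConverges.eventually_extend {A : ℕ → Integrator T} {A₀ : Integrator T}
    (h : TauConverges A A₀) {ε : ℝ} (hε : 0 < ε) :
    ∀ᶠ n in atTop, ∀ s, |(A n).extend s - A₀.extend s| < ε := by
  filter_upwards [Metric.tendstoUniformly_iff.1 h.1 ε hε] with n hn s
  rw [Integrator.extend_eq, Integrator.extend_eq, ← Real.dist_eq, dist_comm]
  exact hn _

/-- Convergence in `D([0,∞))` of a bounded sequence with controlled oscillations from convergence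
at rational times. -/
theorem sConverges_of_tendsto {x : ℕ → SkorokhodSpace} {x₀ : SkorokhodSpace} {y : ℚ≥0 → ℝ}
    (hb : ∀ N : ℝ≥0, 0 < N → ∃ C, ∀ n t, |(x n).stopAt N t| ≤ C)
    (ho : ∀ N : ℝ≥0, 0 < N → ∀ η > 0, ∃ M : ℕ, ∀ n, ¬ OscChain η ((x n).stopAt N) (M + 1) 0)
    (hy : ∀ q : ℚ≥0, Tendsto (fun n => (x n).1 q) atTop (𝓝 (y q)))
    (h0 : ∀ t, Tendsto y (comap (↑) (𝓝[>] t)) (𝓝 (x₀.1 t))) : SConverges x x₀ := by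
  intro T hT A A₀ hA
  obtain ⟨V, hV, hV₀, hVn⟩ := hA.exists_var_le
  -- Strictly beyond `T`, so that `up m t` eventually stays below `N` even at `t = T`.
  let N : ℕ := ⌊T⌋₊ + 1
  have hTN : T < (N : ℝ≥0) := by simpa [N] using Nat.lt_floor_add_one T
  obtain ⟨C, hC⟩ := hb N (zero_le.trans_lt hTN)
  have hC0 : 0 ≤ C := (abs_nonneg _).trans (hC 0 0)
  choose p q hp hq hpT hqT hpq hext hint using fun n => (A n).exists_measure
  obtain ⟨p₀, q₀, hp₀, hq₀, hpT₀, hqT₀, hpq₀, hext₀, hint₀⟩ := A₀.exists_measure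
  have hrestr : ∀ z : SkorokhodSpace,
      z.restrict T = fun t : Icc (0 : ℝ≥0) T => z.stopAt N t := fun z => by
    funext t
    rw [z.stopAt_of_le (t.2.2.trans hTN.le)]
    rfl
  have hupT : ∀ t ≤ T, ∀ᶠ m in atTop, ((up m t : ℚ≥0) : ℝ≥0) < N := fun t ht =>
    (tendsto_nhdsWithin_iff.1 (tendsto_up t)).1.eventually_lt_const (ht.trans_lt hTN)
  -- The limit of the stopped paths at rational times.
  let Y : ℚ≥0 → ℝ := fun r => y (min r N)
  have hY : ∀ r : ℚ≥0, Tendsto (fun n => (x n).stopAt N r) atTop (𝓝 (Y r)) := fun r => by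
    have := hy (min r N)
    simpa [SkorokhodSpace.stopAt, Y] using this
  have hYC : ∀ r, |Y r| ≤ C := fun r =>
    le_of_tendsto (hY r).abs (Eventually.of_forall fun n => hC n r)
  have hYx : ∀ t ≤ T, Tendsto (fun m => Y (up m t)) atTop (𝓝 (x₀.stopAt N t)) := fun t ht => by
    rw [x₀.stopAt_of_le (ht.trans hTN.le)]
    refine ((h0 t).comp (tendsto_up_comap t)).congr' ?_
    filter_upwards [hupT t ht] with m hm
    have : up m t ≤ (N : ℚ≥0) := by exact_mod_cast hm.le
    simp [Y, min_eq_left this]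
  have hx₀C : ∀ t ≤ T, |x₀.stopAt N t| ≤ C := fun t ht =>
    le_of_tendsto (hYx t ht).abs (Eventually.of_forall fun m => hYC _)
  have hae : ∀ μ : Measure ℝ≥0, μ (Ioi T) = 0 → ∀ᵐ t ∂μ, t ≤ T := fun μ hμ => by
    rw [ae_iff]
    simp only [not_le]
    exact hμ
  have lim₁ : ∀ μ : Measure ℝ≥0, IsFiniteMeasure μ → μ (Ioi T) = 0 →
      Tendsto (fun m => ∫ t, Y (up m t) ∂μ) atTop (𝓝 (∫ t, x₀.stopAt N t ∂μ)) := fun μ _ hμ => by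
    refine tendsto_integral_of_dominated_convergence (fun _ => C)
      (fun m => (measurable_comp_up m Y).aestronglyMeasurable) (integrable_const _)
      (fun m => Eventually.of_forall fun t => hYC _) ?_
    filter_upwards [hae μ hμ] with t ht using hYx t ht
  have lim₂ : ∀ μ : Measure ℝ≥0, IsFiniteMeasure μ → ∀ m,
      Tendsto (fun n => ∫ t, (x n).stopAt N (up m t) ∂μ) atTop (𝓝 (∫ t, Y (up m t) ∂μ)) :=
    fun μ _ m => by
    refine tendsto_integral_of_dominated_convergence (fun _ => C)
      (fun n => (measurable_comp_up m fun r => (x n).stopAt N r).aestronglyMeasurable)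
      (integrable_const _) (fun n => Eventually.of_forall fun t => hC _ _) ?_
    exact Eventually.of_forall fun t => hY _
  have e₀ : stieltjesIntegral (x₀.restrict T) A₀ =
      ∫ t, x₀.stopAt N t ∂p₀ - ∫ t, x₀.stopAt N t ∂q₀ := by
    rw [hrestr]
    exact hint₀ _ C (x₀.stopAt_measurable N) hx₀C
  have eₙ : ∀ n, stieltjesIntegral ((x n).restrict T) (A n) =
      ∫ t, (x n).stopAt N t ∂(p n) - ∫ t, (x n).stopAt N t ∂(q n) := fun n => by
    rw [hrestr]
    exact hint n _ C ((x n).stopAt_measurable N) fun t _ => hC n t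
  -- The order of choices is `η`, then `M`, `β`, `δ`, `m`, and finally `n`; four errors of `ε / 4`
  -- are added.
  refine Metric.tendsto_nhds.2 fun ε hε => ?_
  obtain ⟨η, hη, hηε⟩ : ∃ η > 0, 4 * η * (3 * V) ≤ ε / 4 := by
    refine ⟨ε / (48 * (V + 1)), by positivity, ?_⟩
    have : 4 * (ε / (48 * (V + 1))) * (3 * V) = ε / 4 * (V / (V + 1)) := by field_simp; ring
    rw [this]
    exact mul_le_of_le_one_right (by positivity) ((div_le_one (by positivity)).2 (by linarith))
  obtain ⟨M, hM⟩ := ho N (zero_le.trans_lt hTN) η hη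
  obtain ⟨β, hβ, hβε⟩ : ∃ β > 0, (M + 1) * (2 * C * β) ≤ ε / 4 := by
    refine ⟨ε / (8 * (M + 1) * (C + 1)), by positivity, ?_⟩
    have : ((M : ℝ) + 1) * (2 * C * (ε / (8 * (M + 1) * (C + 1)))) = ε / 4 * (C / (C + 1)) := by
      field_simp; ring
    rw [this]
    exact mul_le_of_le_one_right (by positivity) ((div_le_one (by positivity)).2 (by linarith))
  obtain ⟨δ, hδ, hmod⟩ := A₀.exists_extend_modulus (half_pos hβ)
  obtain ⟨m, hm₁, hm₂⟩ : ∃ m : ℕ, 1 / ((m : ℝ) + 1) < δ ∧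
      |(∫ t, Y (up m t) ∂p₀ - ∫ t, Y (up m t) ∂q₀) -
        (∫ t, x₀.stopAt N t ∂p₀ - ∫ t, x₀.stopAt N t ∂q₀)| < ε / 4 := by
    have h1 := (tendsto_one_div_add_atTop_nhds_zero_nat (𝕜 := ℝ)).eventually_lt_const hδ
    have h2 := Metric.tendsto_nhds.1 ((lim₁ p₀ hp₀ hpT₀).sub (lim₁ q₀ hq₀ hqT₀)) (ε / 4)
      (by positivity)
    exact (h1.and h2).exists
  have h3 := Metric.tendsto_nhds.1 ((lim₂ p₀ hp₀ m).sub (lim₂ q₀ hq₀ m)) (ε / 4) (by positivity)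
  -- `β` is spent as `β / 4` at each of `T` and `s` for `A n` against `A₀`, and `β / 2` for moving
  -- from `s` to `down m s`.
  have hβ4 : 0 < β / 4 := by positivity
  filter_upwards [h3, hA.eventually_extend hβ4] with n hn₁ hn₂
  rw [Real.dist_eq] at hn₁ ⊢
  rw [e₀, eₙ]
  have h4 := abs_sub_le_of_up (p := p n) (q := q n) (p₀ := p₀) (q₀ := q₀) (β := β) (V := 3 * V)
    ((x n).stopAt_continuousWithinAt N) (hC n) hη m (fun s => by
      rw [hext, hext₀]
      have a1 := abs_lt.1 (hn₂ T)
      have a2 := abs_lt.1 (hn₂ s)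
      have a3 := abs_lt.1 (hmod s (down m s) (by
        rw [NNReal.dist_eq, abs_of_nonneg (sub_nonneg.2 (NNReal.coe_le_coe.2 (down_le m s)))]
        have : (s : ℝ) ≤ down m s + 1 / (m + 1) := by exact_mod_cast le_down_add m s
        linarith))
      rw [abs_le]
      constructor <;> linarith [a1.1, a1.2, a2.1, a2.2, a3.1, a3.2])
    ((hpq n).trans (by linarith [hVn n])) (hpq₀.trans (by linarith)) M (hM n)
  have b1 := abs_le.1 h4
  have b2 := abs_lt.1 hn₁
  have b3 := abs_lt.1 hm₂
  rw [abs_lt]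
  constructor <;> linarith [b1.1, b1.2, b2.1, b2.2, b3.1, b3.2]

end Convergence

/-- A uniformly bounded set of paths with uniformly bounded numbers of oscillations is relatively
sequentially compact. -/
theorem isRelativelySeqCompact_of_oscillations {K : Set SkorokhodSpace} (hb : UniformlyBounded K)
    (ho : UniformlyBoundedOscillations K) : IsRelativelySeqCompact K := by
  intro x hx
  have hpos : ∀ q : ℚ≥0, (0 : ℝ≥0) < q + 1 := fun q => by positivity
  choose C hC using fun q : ℚ≥0 => hb.exists_bound (hpos q)
  obtain ⟨y, -, φ, hφ, hlim⟩ := (isCompact_univ_pi fun q : ℚ≥0 =>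
    isCompact_Icc (a := -C q) (b := C q)).tendsto_subseq (x := fun n (q : ℚ≥0) => (x n).1 q)
      (fun n q _ => abs_le.1 (hC q _ (hx n) q (by simp)))
  have hy : ∀ q : ℚ≥0, Tendsto (fun n => (x (φ n)).1 q) atTop (𝓝 (y q)) :=
    fun q => (tendsto_pi_nhds.1 hlim) q
  have hyN : ∀ N : ℕ, 0 < N → ∀ η > 0, ∃ k,
      ∀ s, ¬ OscChain η (fun q : ℚ≥0 => y (min q N)) k s := by
    intro N hN η hη
    obtain ⟨M, hM⟩ := ho.exists_bound (T := N) (by exact_mod_cast hN) hη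
    refine ⟨M + 1, fun s hs => ?_⟩
    have h1 : ∀ q : ℚ≥0, Tendsto (fun n => ((x (φ n)).stopAt N ∘ ((↑) : ℚ≥0 → ℝ≥0)) q) atTop
        (𝓝 (y (min q N))) := fun q => by
      have := hy (min q N)
      simpa [SkorokhodSpace.stopAt] using this
    obtain ⟨n, hn⟩ := (OscChain.eventually h1 hs).exists
    exact hM _ (hx _) _ (OscChain.of_comp NNRat.cast_mono hη.le hn)
  have hcongr : ∀ (N : ℕ) (I : Set ℝ≥0) (t : ℝ≥0) (l : ℝ), t < N →
      Tendsto (fun q : ℚ≥0 => y (min q N)) (comap (↑) (𝓝[I] t)) (𝓝 l) →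
      Tendsto y (comap (↑) (𝓝[I] t)) (𝓝 l) := by
    intro N I t l ht h
    refine h.congr' ?_
    have : ∀ᶠ q : ℚ≥0 in comap (↑) (𝓝[I] t), (q : ℝ≥0) < N :=
      preimage_mem_comap (m := ((↑) : ℚ≥0 → ℝ≥0)) (nhdsWithin_le_nhds (Iio_mem_nhds ht))
    filter_upwards [this] with q hq
    rw [min_eq_left (by exact_mod_cast hq.le)]
  have hN : ∀ t : ℝ≥0, t < ((⌊t⌋₊ + 1 : ℕ) : ℝ≥0) := fun t => by
    simpa using Nat.lt_floor_add_one t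
  -- Right limits are local, so stopping at an integer beyond `t` does not affect them.
  choose x₀ hx₀ using fun t => exists_right_limit (hyN (⌊t⌋₊ + 1) (Nat.succ_pos _)) t
  replace hx₀ : ∀ t, Tendsto y (comap (↑) (𝓝[>] t)) (𝓝 (x₀ t)) := fun t =>
    hcongr _ _ t _ (hN t) (hx₀ t)
  refine ⟨φ, hφ, ⟨x₀, fun t => ?_, fun t ht => ?_⟩, ?_⟩
  · rw [← continuousWithinAt_Ioi_iff_Ici]
    exact tendsto_of_right_limits hx₀ isOpen_Ioi (hx₀ t)
  · obtain ⟨l, hl⟩ := exists_left_limit (hyN (⌊t⌋₊ + 1) (Nat.succ_pos _)) ht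
    exact ⟨l, tendsto_of_right_limits hx₀ isOpen_Iio (hcongr _ _ t _ (hN t) hl)⟩
  · refine sConverges_of_tendsto (y := y) (fun N hN => ?_) (fun N hN η hη => ?_) hy hx₀
    · obtain ⟨C, hC⟩ := hb.exists_bound hN
      exact ⟨C, fun n t => hC _ (hx _) _ (min_le_right _ _)⟩
    · obtain ⟨M, hM⟩ := ho.exists_bound hN hη
      exact ⟨M, fun n => hM _ (hx _) 0⟩


/-! ### Up-crossings versus oscillations -/

section Crossings

variable {α : Type*} [LinearOrder α]

lemma upcrossingNumber_le_oscillationNumber (a b : ℝ) (f : α → ℝ) :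
    upcrossingNumber a b f ≤ oscillationNumber (b - a) f := by
  refine iSup₂_le fun k ⟨s, t, h1, h2, h3⟩ => le_iSup₂_of_le k ⟨s, t, h1, fun i j hij =>
    (h2 i j hij).le, fun i => ?_⟩ le_rfl
  have := h3 i
  exact lt_of_lt_of_le (by linarith) (le_abs_self _)

/-- Oscillations across the same pair of levels in the same direction give up-crossings. -/
lemma le_upcrossingNumber_of_levels {f : α → ℝ} {a b : ℝ} (hab : a < b) {k m : ℕ}
    {s t : Fin k → α} (h1 : ∀ i, s i < t i) (h2 : ∀ i j, i < j → t i ≤ s j)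
    (S : Finset (Fin k)) (hS : m + 1 ≤ S.card)
    (h : (∀ i ∈ S, f (s i) < a ∧ b < f (t i)) ∨ ∀ i ∈ S, f (t i) < a ∧ b < f (s i)) :
    (m : ℕ∞) ≤ upcrossingNumber a b f := by
  let e := S.orderEmbOfCardLe hS
  have he : ∀ i, e i ∈ S := fun i => S.orderEmbOfCardLe_mem hS i
  rcases h with h | h
  · refine le_iSup₂_of_le (m + 1) ⟨s ∘ e, t ∘ e, fun i => h1 _, fun i j hij => ?_,
      fun i => h _ (he i)⟩ (by exact_mod_cast Nat.le_succ m)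
    refine (h2 _ _ (e.strictMono hij)).lt_of_ne fun heq => ?_
    have i1 := (h _ (he i)).2
    have i2 := (h _ (he j)).1
    have heq' : t (e i) = s (e j) := heq
    rw [heq'] at i1
    linarith
  -- Between consecutive down-crossings lies an up-crossing, from `t` of one to `s` of the next;
  -- this loses one.
  · refine le_iSup₂_of_le m ⟨fun i => t (e i.castSucc), fun i => s (e i.succ), fun i => ?_,
      fun i j hij => ?_, fun i => ⟨(h _ (he _)).1, (h _ (he _)).2⟩⟩ le_rfl
    · refine (h2 _ _ (e.strictMono (Fin.castSucc_lt_succ))).lt_of_ne fun heq => ?_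
      have i1 := (h _ (he i.castSucc)).1
      have i2 := (h _ (he i.succ)).2
      rw [heq] at i1
      linarith
    · refine (h1 _).trans_le ?_
      have hle : i.succ ≤ j.castSucc := Fin.succ_le_castSucc_iff.2 hij
      rcases hle.eq_or_lt with heq | hlt
      · rw [heq]
      · exact (h2 _ _ (e.strictMono hlt)).trans (h1 _).le

/-- The number of oscillations of a bounded function in terms of the numbers of up-crossings of
finitely many pairs of levels. -/
lemma oscillationNumber_le {f : α → ℝ} {C η : ℝ} (hC : ∀ t, |f t| ≤ C) (hη : 0 < η) {J M : ℕ}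
    (hJ : 2 * C / (η / 3) + 1 < J)
    (hU : ∀ j < J, upcrossingNumber (-C + j * (η / 3)) (-C + (j + 1) * (η / 3)) f ≤ M) :
    oscillationNumber η f ≤ (J * 2 * (M + 2) : ℕ) := by
  refine iSup₂_le fun k ⟨s, t, h1, h2, h3⟩ => ?_
  by_contra hk
  have hk' : J * 2 * (M + 2) ≤ k := by
    have := not_le.1 hk
    exact (Nat.cast_lt.1 this).le
  -- The first grid level above `c` is within `η / 3`, so the cell starting there ends by `c +
  -- 2η/3`, below `d`.
  have hh : 0 < η / 3 := by positivity
  have level : ∀ c d : ℝ, |c| ≤ C → η < d - c → ∃ j : Fin J,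
      c < -C + (j : ℕ) * (η / 3) ∧ -C + ((j : ℕ) + 1) * (η / 3) < d := by
    intro c d hc hcd
    have hc' := abs_le.1 hc
    have hz : 0 ≤ (c + C) / (η / 3) := div_nonneg (by linarith) hh.le
    have f1 := Nat.floor_le hz
    have f2 := Nat.lt_floor_add_one ((c + C) / (η / 3))
    rw [le_div_iff₀ hh] at f1
    rw [div_lt_iff₀ hh] at f2
    have hlt : ⌊(c + C) / (η / 3)⌋₊ + 1 < J := by
      have : (⌊(c + C) / (η / 3)⌋₊ : ℝ) ≤ 2 * C / (η / 3) :=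
        (Nat.floor_le hz).trans (by gcongr; linarith)
      exact_mod_cast (by linarith : (⌊(c + C) / (η / 3)⌋₊ : ℝ) + 1 < J)
    refine ⟨⟨_, hlt⟩, ?_, ?_⟩ <;> push_cast <;> linarith
  have color : ∀ i, ∃ c : Fin J × Bool, if c.2
      then f (s i) < -C + (c.1 : ℕ) * (η / 3) ∧ -C + ((c.1 : ℕ) + 1) * (η / 3) < f (t i)
      else f (t i) < -C + (c.1 : ℕ) * (η / 3) ∧ -C + ((c.1 : ℕ) + 1) * (η / 3) < f (s i) := by
    intro i
    rcases lt_abs.1 (h3 i) with h | h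
    · obtain ⟨j, hj⟩ := level _ _ (hC (s i)) h
      exact ⟨(j, true), by simpa using hj⟩
    · obtain ⟨j, hj⟩ := level _ _ (hC (t i)) (by linarith : η < f (s i) - f (t i))
      exact ⟨(j, false), by simpa using hj⟩
  choose c hc using color
  have hJ0 : 0 < J := by
    have hC0 : 0 ≤ 2 * C / (η / 3) := by
      rcases k with _ | k
      · exact absurd zero_le hk
      · have := (abs_nonneg _).trans (hC (s 0))
        positivity
    exact_mod_cast (by linarith : (0 : ℝ) < J)
  have : Nonempty (Fin J × Bool) := ⟨(⟨0, hJ0⟩, true)⟩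
  -- Some level and direction occur `M + 2` times, giving `M + 1` up-crossings.
  obtain ⟨d, hd⟩ := Fintype.exists_le_card_fiber_of_mul_le_card c (n := M + 2)
    (by simpa using hk')
  have hup := le_upcrossingNumber_of_levels (m := M + 1) (f := f)
    (by nlinarith : -C + (d.1 : ℕ) * (η / 3) < -C + ((d.1 : ℕ) + 1) * (η / 3)) h1 h2 _ hd (by
      obtain ⟨j, _ | _⟩ := d
      · right
        intro i hi
        simpa [(Finset.mem_filter.1 hi).2] using hc i
      · left
        intro i hi
        simpa [(Finset.mem_filter.1 hi).2] using hc i)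
  have := Nat.cast_le.1 (hup.trans (hU d.1 d.1.2))
  omega

variable {K : Set SkorokhodSpace}

lemma UniformlyBoundedOscillations.upcrossings (h : UniformlyBoundedOscillations K) :
    UniformlyBoundedUpcrossings K := by
  intro T hT a b hab
  refine lt_of_le_of_lt ?_ (h T hT (b - a) (sub_pos.2 hab))
  exact iSup₂_mono fun x _ => upcrossingNumber_le_oscillationNumber a b (x.restrict T)

lemma UniformlyBoundedUpcrossings.oscillations (h : UniformlyBoundedUpcrossings K)
    (hb : UniformlyBounded K) : UniformlyBoundedOscillations K := by
  intro T hT η hη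
  obtain ⟨C, hC⟩ := hb.exists_bound hT
  obtain ⟨J, hJ⟩ := exists_nat_gt (2 * C / (η / 3) + 1)
  have hlt : ∀ j : ℕ, -C + j * (η / 3) < -C + (j + 1) * (η / 3) := fun j => by nlinarith
  choose U hU using fun j : ℕ => WithTop.ne_top_iff_exists.1 (h T hT _ _ (hlt j)).ne
  refine lt_of_le_of_lt (iSup₂_le fun x hx => ?_)
    (WithTop.coe_lt_top (J * 2 * ((Finset.range J).sup U + 2)))
  have hC' : ∀ t, |x.restrict T t| ≤ C := fun t => hC x hx t.1 t.2.2
  refine oscillationNumber_le hC' hη hJ fun j hj => ?_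
  refine (le_iSup₂_of_le x hx le_rfl).trans ((hU j).ge.trans ?_)
  exact (Nat.cast_le (α := ℕ∞)).2 (Finset.le_sup (f := U) (Finset.mem_range.2 hj))

end Crossings


/-! ### Ramps imitating point masses -/

noncomputable section

/-- The continuous function that is `0` before `u`, `1` after `u + δ` and affine in between. -/
def ramp (δ : ℝ) (u t : ℝ≥0) : ℝ := min 1 (max 0 ((t - u) / δ))

section Ramp

variable {δ : ℝ}

lemma ramp_nonneg (u t : ℝ≥0) : 0 ≤ ramp δ u t := le_min zero_le_one (le_max_left _ _)

lemma ramp_le_one (u t : ℝ≥0) : ramp δ u t ≤ 1 := min_le_left _ _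

lemma ramp_mono (hδ : 0 < δ) (u : ℝ≥0) : Monotone (ramp δ u) := by
  intro s t h
  unfold ramp
  gcongr

lemma ramp_anti (hδ : 0 < δ) (t : ℝ≥0) : Antitone fun u => ramp δ u t := by
  intro s t h
  show min 1 (max 0 (_ / δ)) ≤ min 1 (max 0 (_ / δ))
  gcongr

lemma ramp_continuous (u : ℝ≥0) : Continuous (ramp δ u) := by
  unfold ramp
  fun_prop

lemma ramp_of_le (hδ : 0 < δ) {u t : ℝ≥0} (h : t ≤ u) : ramp δ u t = 0 := by
  have h1 : ((t : ℝ) - u) / δ ≤ 0 :=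
    div_nonpos_of_nonpos_of_nonneg (sub_nonpos.2 (NNReal.coe_le_coe.2 h)) hδ.le
  rw [ramp, max_eq_left h1, min_eq_right zero_le_one]

lemma ramp_of_ge (hδ : 0 < δ) {u t : ℝ≥0} (h : (u : ℝ) + δ ≤ t) : ramp δ u t = 1 := by
  have h1 : 1 ≤ ((t : ℝ) - u) / δ := (one_le_div hδ).2 (by linarith)
  rw [ramp, min_eq_left (le_max_of_le_right h1)]

end Ramp

namespace Integrator

variable {T : ℝ≥0} {δ : ℝ}

/-- The ramp at `u` as a Stieltjes function on `[0,T]`. -/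
def rampStieltjes (T : ℝ≥0) (hδ : 0 < δ) (u : ℝ≥0) : StieltjesFunction (Icc (0 : ℝ≥0) T) where
  toFun t := ramp δ u t
  mono' _ _ h := ramp_mono hδ u h
  right_continuous' _ :=
    ((ramp_continuous u).comp continuous_subtype_val).continuousWithinAt

lemma rampStieltjes_apply (hδ : 0 < δ) (u : ℝ≥0) (t : Icc (0 : ℝ≥0) T) :
    rampStieltjes T hδ u t = ramp δ u t := rfl

instance (hδ : 0 < δ) (u : ℝ≥0) : IsFiniteMeasure (rampStieltjes T hδ u).measure :=
  StieltjesFunction.isFiniteMeasure_of_Icc _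

lemma real_measure_rampStieltjes_Iic (hδ : 0 < δ) (u : ℝ≥0) (t : Icc (0 : ℝ≥0) T) :
    (rampStieltjes T hδ u).measure.real (Iic t) = ramp δ u t := by
  rw [StieltjesFunction.real_measure_Iic_of_left, rampStieltjes_apply, rampStieltjes_apply,
    ramp_of_le hδ (t := left T) zero_le, sub_zero]

lemma real_measure_rampStieltjes_univ (hδ : 0 < δ) {u : ℝ≥0} (hu : (u : ℝ) + δ ≤ T) :
    (rampStieltjes T hδ u).measure.real univ = 1 := by
  rw [← Iic_right, real_measure_rampStieltjes_Iic]
  exact ramp_of_ge hδ hu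

lemma ae_rampStieltjes (hδ : 0 < δ) {u : ℝ≥0} (hu : (u : ℝ) + δ ≤ T) :
    ∀ᵐ t : Icc (0 : ℝ≥0) T ∂(rampStieltjes T hδ u).measure,
      u ≤ t.1 ∧ (t.1 : ℝ) ≤ u + δ := by
  have huT : u ≤ T := NNReal.coe_le_coe.1 (by linarith)
  let a : Icc (0 : ℝ≥0) T := ⟨u, zero_le, huT⟩
  let b : Icc (0 : ℝ≥0) T := ⟨u + δ.toNNReal, zero_le, NNReal.coe_le_coe.1 (by
    rw [NNReal.coe_add, Real.coe_toNNReal _ hδ.le]; exact hu)⟩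
  have hb : (b.1 : ℝ) = u + δ := by
    show ((u + δ.toNNReal : ℝ≥0) : ℝ) = u + δ
    rw [NNReal.coe_add, Real.coe_toNNReal _ hδ.le]
  have h1 : (rampStieltjes T hδ u).measure (Iic a) = 0 := by
    rw [StieltjesFunction.measure_Iic_of_left, rampStieltjes_apply, rampStieltjes_apply,
      ramp_of_le hδ (le_refl u), ramp_of_le hδ (t := left T) zero_le]
    simp
  have h2 : (rampStieltjes T hδ u).measure (Ioc b (right T)) = 0 := by
    rw [StieltjesFunction.measure_Ioc, rampStieltjes_apply, rampStieltjes_apply,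
      ramp_of_ge hδ hb.ge, ramp_of_ge (t := right T) hδ hu]
    simp
  refine measure_mono_null (fun t ht => ?_) (measure_union_null h1 h2)
  by_contra hn
  have hn' := not_or.1 hn
  refine ht ⟨(not_le.1 hn'.1).le, ?_⟩
  have : t ≤ b := le_of_not_gt fun h => hn'.2 ⟨h, le_right t⟩
  rw [← hb]
  exact NNReal.coe_le_coe.2 this

/-- The ramp is the distribution function of a probability measure on `[u, u + δ]`, so the integral
is an average of values near `f u`. -/
lemma integrable_and_abs_integral_rampStieltjes_sub_le (hδ : 0 < δ) {u : ℝ≥0}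
    (hu : (u : ℝ) + δ ≤ T) {f : ℝ≥0 → ℝ} (hf : Measurable f) {ε : ℝ}
    (h : ∀ t : ℝ≥0, u ≤ t → (t : ℝ) ≤ u + δ → |f t - f u| ≤ ε) :
    Integrable (fun t : Icc (0 : ℝ≥0) T => f t) (rampStieltjes T hδ u).measure ∧
      |∫ t : Icc (0 : ℝ≥0) T, f t ∂(rampStieltjes T hδ u).measure - f u| ≤ ε := by
  have hae : ∀ᵐ t : Icc (0 : ℝ≥0) T ∂(rampStieltjes T hδ u).measure, ‖f t - f u‖ ≤ ε := by
    filter_upwards [ae_rampStieltjes hδ hu] with t ht using h t ht.1 ht.2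
  have hm : Measurable fun t : Icc (0 : ℝ≥0) T => f t := hf.comp measurable_subtype_coe
  have hi : Integrable (fun t : Icc (0 : ℝ≥0) T => f t - f u) (rampStieltjes T hδ u).measure :=
    Integrable.of_bound (hm.sub_const _).aestronglyMeasurable ε hae
  have hi' : Integrable (fun t : Icc (0 : ℝ≥0) T => f t) (rampStieltjes T hδ u).measure :=
    (hi.add (integrable_const (f u))).congr (Eventually.of_forall fun t => by simp)
  refine ⟨hi', ?_⟩
  have h1 := norm_integral_le_of_norm_le_const hae
  rw [integral_sub hi' (integrable_const _), integral_const,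
    real_measure_rampStieltjes_univ hδ hu] at h1
  simpa using h1

variable {ι : Type*} [Fintype ι]

/-- The increments are dominated by those of the monotone function with weights `|w i|`. -/
lemma eVariationOn_sum_ramp_le (hδ : 0 < δ) (w : ι → ℝ) (u : ι → ℝ≥0) :
    eVariationOn (fun t : Icc (0 : ℝ≥0) T => ∑ i, w i * ramp δ (u i) t) univ ≤
      ENNReal.ofReal (∑ i, |w i|) := by
  let G : Icc (0 : ℝ≥0) T → ℝ := fun t => ∑ i, |w i| * ramp δ (u i) t
  have hG : Monotone G := fun s t h => Finset.sum_le_sum fun i _ =>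
    mul_le_mul_of_nonneg_left (ramp_mono hδ _ h) (abs_nonneg _)
  have key : ∀ s t : Icc (0 : ℝ≥0) T, s ≤ t →
      |∑ i, w i * ramp δ (u i) t - ∑ i, w i * ramp δ (u i) s| ≤ G t - G s := by
    intro s t h
    rw [← Finset.sum_sub_distrib, ← Finset.sum_sub_distrib]
    refine (Finset.abs_sum_le_sum_abs _ _).trans (Finset.sum_le_sum fun i _ => ?_)
    rw [← mul_sub, ← mul_sub, abs_mul, abs_of_nonneg (sub_nonneg.2 (ramp_mono hδ (u i) h))]
  have h1 : eVariationOn (fun t : Icc (0 : ℝ≥0) T => ∑ i, w i * ramp δ (u i) t) univ ≤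
      eVariationOn G univ := by
    refine iSup_mono fun ⟨n, v, hv⟩ => Finset.sum_le_sum fun i _ => ?_
    have hle := hv.1 (Nat.le_succ i)
    rw [edist_dist, edist_dist, Real.dist_eq, Real.dist_eq, abs_of_nonneg (sub_nonneg.2 (hG hle))]
    exact ENNReal.ofReal_le_ofReal (key _ _ hle)
  have h2 := ((hG.monotoneOn univ).eVariationOn_eq (mem_univ (left T)) (mem_univ (right T))).le
  rw [univ_inter, ← Iic_eq_Icc, Iic_right] at h2
  refine h1.trans (h2.trans (ENNReal.ofReal_le_ofReal ?_))
  have h3 : 0 ≤ G (left T) := Finset.sum_nonneg fun i _ =>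
    mul_nonneg (abs_nonneg _) (ramp_nonneg _ _)
  have h4 : G (right T) ≤ ∑ i, |w i| := Finset.sum_le_sum fun i _ =>
    mul_le_of_le_one_right (abs_nonneg _) (ramp_le_one _ _)
  linarith

/-- The linear combination of ramps at the points `u i` with the weights `w i`. -/
def rampSum (T : ℝ≥0) (hδ : 0 < δ) (w : ι → ℝ) (u : ι → ℝ≥0) : Integrator T where
  toFun t := ∑ i, w i * ramp δ (u i) t
  continuous := by
    have := fun i => (ramp_continuous (δ := δ) (u i)).comp
      (continuous_subtype_val (p := (· ∈ Icc (0 : ℝ≥0) T)))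
    exact continuous_finsetSum _ fun i _ => (this i).const_mul _
  boundedVariation := ne_top_of_le_ne_top ENNReal.ofReal_ne_top (eVariationOn_sum_ramp_le hδ w u)
  map_zero := Finset.sum_eq_zero fun i _ => by rw [ramp_of_le hδ zero_le, mul_zero]

lemma rampSum_apply (hδ : 0 < δ) (w : ι → ℝ) (u : ι → ℝ≥0) (t : Icc (0 : ℝ≥0) T) :
    (rampSum T hδ w u).toFun t = ∑ i, w i * ramp δ (u i) t := rfl

lemma stieltjesIntegral_rampSum (hδ : 0 < δ) (w : ι → ℝ) (u : ι → ℝ≥0)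
    {f : Icc (0 : ℝ≥0) T → ℝ} (hf : ∀ i, Integrable f (rampStieltjes T hδ (u i)).measure) :
    stieltjesIntegral f (rampSum T hδ w u) =
      ∑ i, w i * ∫ t, f t ∂(rampStieltjes T hδ (u i)).measure := by
  have h := (rampSum T hδ w u).vectorMeasure_eq
    (∑ i, w i • (rampStieltjes T hδ (u i)).measure.toSignedMeasure) fun t => by
      rw [rampSum_apply, sum_apply]
      refine Finset.sum_congr rfl fun i _ => ?_
      rw [smul_apply, Measure.toSignedMeasure_apply_measurable measurableSet_Iic,
        real_measure_rampStieltjes_Iic, smul_eq_mul]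
  have hi : ∀ i, (rampStieltjes T hδ (u i)).measure.toSignedMeasure.Integrable f := fun i => by
    simpa [VectorMeasure.Integrable] using hf i
  rw [stieltjesIntegral, h, VectorMeasure.integral_finsetSum_vectorMeasure
    fun i _ => (hi i).smul_vectorMeasure (w i)]
  refine Finset.sum_congr rfl fun i _ => ?_
  rw [VectorMeasure.integral_smul_vectorMeasure, VectorMeasure.integral_toSignedMeasure,
    smul_eq_mul]

/-- The zero integrator. -/
def zero (T : ℝ≥0) : Integrator T where
  toFun _ := 0
  continuous := continuous_const
  boundedVariation := by
    rw [BoundedVariationOn, eVariationOn.constant_on (by rintro _ ⟨_, _, rfl⟩ _ ⟨_, _, rfl⟩; rfl)]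
    exact ENNReal.zero_ne_top
  map_zero := rfl

lemma stieltjesIntegral_zero (f : Icc (0 : ℝ≥0) T → ℝ) : stieltjesIntegral f (zero T) = 0 := by
  rw [stieltjesIntegral, (zero T).vectorMeasure_eq 0 fun t => by simp [zero],
    VectorMeasure.integral_zero_vectorMeasure]

end Integrator

namespace SkorokhodSpace

lemma measurable (x : SkorokhodSpace) : Measurable x.1 :=
  measurable_of_right_continuous x.2.1

lemma exists_right_modulus (x : SkorokhodSpace) {ι : Type*} [Finite ι] (u : ι → ℝ≥0) {ε : ℝ}
    (hε : 0 < ε) : ∃ δ : ℝ, 0 < δ ∧ δ ≤ 1 ∧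
      ∀ i, ∀ t : ℝ≥0, u i ≤ t → (t : ℝ) ≤ u i + δ → |x.1 t - x.1 (u i)| ≤ ε := by
  have h : ∀ i, ∀ᶠ δ in 𝓝[>] (0 : ℝ),
      ∀ t : ℝ≥0, u i ≤ t → (t : ℝ) ≤ u i + δ → |x.1 t - x.1 (u i)| ≤ ε := by
    intro i
    obtain ⟨r, hr, hx⟩ := Metric.continuousWithinAt_iff.1 (x.2.1 (u i)) ε hε
    filter_upwards [Ioo_mem_nhdsGT hr] with δ hδ t h1 h2
    refine (hx h1 ?_).le
    rw [NNReal.dist_eq, abs_of_nonneg (sub_nonneg.2 (NNReal.coe_le_coe.2 h1))]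
    linarith [hδ.2]
  have h1 : ∀ᶠ δ in 𝓝[>] (0 : ℝ), δ ∈ Ioo (0 : ℝ) 1 := Ioo_mem_nhdsGT zero_lt_one
  obtain ⟨δ, h2, h3⟩ := ((eventually_all.2 h).and h1).exists
  exact ⟨δ, h3.1, h3.2.le, h2⟩

/-- A linear combination of values of a path is approximated by integrals of this path. -/
lemma exists_integrator (x : SkorokhodSpace) {ι : Type*} [Fintype ι] (w : ι → ℝ) (u : ι → ℝ≥0)
    {T : ℝ≥0} (hu : ∀ i, u i ≤ T) {ε β : ℝ} (hε : 0 < ε)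
    (hβ : ∀ ρ : ℝ≥0 → ℝ, Antitone ρ → (∀ t, 0 ≤ ρ t) → (∀ t, ρ t ≤ 1) →
      |∑ i, w i * ρ (u i)| ≤ β) :
    ∃ A : Integrator (T + 1), (∀ t, |A.toFun t| ≤ β) ∧
      eVariationOn A.toFun univ ≤ ENNReal.ofReal (∑ i, |w i|) ∧
      |stieltjesIntegral (x.restrict (T + 1)) A - ∑ i, w i * x.1 (u i)| ≤ (∑ i, |w i|) * ε := by
  obtain ⟨δ, hδ, hδ1, hx⟩ := x.exists_right_modulus u hε
  refine ⟨Integrator.rampSum (T + 1) hδ w u, fun t => ?_,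
    Integrator.eVariationOn_sum_ramp_le hδ w u, ?_⟩
  -- For fixed `t`, the ramp is antitone in its starting point, so `hβ` bounds `A` at `t`.
  · exact hβ (fun u => ramp δ u t) (ramp_anti hδ t) (fun u => ramp_nonneg u t)
      fun u => ramp_le_one u t
  · have huT : ∀ i, ((u i : ℝ)) + δ ≤ (T + 1 : ℝ≥0) := fun i => by
      have : (u i : ℝ) ≤ T := NNReal.coe_le_coe.2 (hu i)
      push_cast
      linarith
    have key := fun i => Integrator.integrable_and_abs_integral_rampStieltjes_sub_le hδ (huT i)
      x.measurable (hx i)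
    have e := Integrator.stieltjesIntegral_rampSum hδ w u (f := x.restrict (T + 1))
      fun i => (key i).1
    rw [e, ← Finset.sum_sub_distrib, Finset.sum_mul]
    refine (Finset.abs_sum_le_sum_abs _ _).trans (Finset.sum_le_sum fun i _ => ?_)
    rw [← mul_sub, abs_mul]
    exact mul_le_mul_of_nonneg_left (key i).2 (abs_nonneg _)

end SkorokhodSpace

/-! ### Necessity of the bounds -/

/-- In a relatively compact set, linear combinations of values with bounded weights and small
distribution functions cannot stay away from zero. -/
lemma IsRelativelySeqCompact.false_of_sums {K : Set SkorokhodSpace}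
    (hK : IsRelativelySeqCompact K) {T : ℝ≥0} {c : ℝ} (hc : 0 < c)
    (h : ∀ n : ℕ, ∃ (ι : Type) (_ : Fintype ι) (w : ι → ℝ) (u : ι → ℝ≥0), ∃ x ∈ K,
      (∀ i, u i ≤ T) ∧ ∑ i, |w i| ≤ 2 ∧ (∀ ρ : ℝ≥0 → ℝ, Antitone ρ → (∀ t, 0 ≤ ρ t) →
        (∀ t, ρ t ≤ 1) → |∑ i, w i * ρ (u i)| ≤ 1 / (n + 1)) ∧ c ≤ ∑ i, w i * x.1 (u i)) :
    False := by
  have h' : ∀ n : ℕ, ∃ x ∈ K, ∃ A : Integrator (T + 1), (∀ t, |A.toFun t| ≤ 1 / (n + 1)) ∧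
      eVariationOn A.toFun univ ≤ ENNReal.ofReal 2 ∧
      c / 2 ≤ stieltjesIntegral (x.restrict (T + 1)) A := by
    intro n
    obtain ⟨ι, _, w, u, x, hx, hu, hw, hβ, hsum⟩ := h n
    obtain ⟨A, h1, h2, h3⟩ := x.exists_integrator w u hu (ε := c / 4) (by positivity) hβ
    refine ⟨x, hx, A, h1, h2.trans (ENNReal.ofReal_le_ofReal hw), ?_⟩
    have h4 := (abs_le.1 h3).1
    have h5 : (∑ i, |w i|) * (c / 4) ≤ 2 * (c / 4) :=
      mul_le_mul_of_nonneg_right hw (by positivity)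
    linarith
  choose x hx A hA hv hs using h'
  obtain ⟨φ, hφ, x₀, hconv⟩ := hK x hx
  have hτ : TauConverges (fun n => A (φ n)) (Integrator.zero (T + 1)) := by
    refine ⟨Metric.tendstoUniformly_iff.2 fun ε hε => ?_, ?_⟩
    · have h1 := (tendsto_one_div_add_atTop_nhds_zero_nat (𝕜 := ℝ)).comp hφ.tendsto_atTop
      filter_upwards [h1.eventually_lt_const hε] with n hn t
      rw [dist_comm, Real.dist_eq]
      simpa [Integrator.zero] using (hA (φ n) t).trans_lt hn
    · exact (iSup_le fun n => hv (φ n)).trans_lt ENNReal.ofReal_lt_top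
  have hlim := hconv (T + 1) (by positivity) _ _ hτ
  rw [Integrator.stieltjesIntegral_zero] at hlim
  have := ge_of_tendsto hlim (Eventually.of_forall fun n => hs (φ n))
  linarith

/-- Test with a single mass `± 1 / (n + 1)` at a point where `|x|` exceeds `n + 1`. -/
lemma IsRelativelySeqCompact.uniformlyBounded {K : Set SkorokhodSpace}
    (hK : IsRelativelySeqCompact K) : UniformlyBounded K := by
  intro T hT
  by_contra hsup
  refine hK.false_of_sums (T := T) zero_lt_one fun n => ?_
  obtain ⟨x, hx, t, ht, hlt⟩ : ∃ x ∈ K, ∃ t ≤ T, (n + 1 : ℝ) < |x.1 t| := by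
    by_contra! hc
    refine hsup (lt_of_le_of_lt (iSup₂_le fun x hx => iSup_le fun t => ?_)
      (ENNReal.ofReal_lt_top (r := (n + 1 : ℝ))))
    rw [Real.enorm_eq_ofReal_abs]
    exact ENNReal.ofReal_le_ofReal (hc x hx t.1 t.2.2)
  have hn : (0 : ℝ) < n + 1 := by positivity
  have hsgn : |(SignType.sign (x.1 t) : ℝ)| ≤ 1 := by
    rcases lt_trichotomy (x.1 t) 0 with h | h | h <;> simp [h]
  refine ⟨Unit, inferInstance, fun _ => SignType.sign (x.1 t) / (n + 1), fun _ => t, x, hx,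
    fun _ => ht, ?_, fun ρ _ h0 h1 => ?_, ?_⟩
  · rw [Fintype.sum_unique, abs_div, abs_of_pos hn, div_le_iff₀ hn]
    nlinarith
  · rw [Fintype.sum_unique, abs_mul, abs_div, abs_of_pos hn, abs_of_nonneg (h0 t)]
    calc _ ≤ 1 / ((n : ℝ) + 1) * 1 :=
        mul_le_mul (div_le_div_of_nonneg_right hsgn hn.le) (h1 t) (h0 t) (by positivity)
      _ = _ := mul_one _
  · rw [Fintype.sum_unique, div_mul_eq_mul_div, sign_mul_self, le_div_iff₀ hn]
    linarith

/-- The drops of `ρ` over disjoint intervals add up to at most its total drop. -/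
lemma sum_antitone_sub_le {α : Type*} [LinearOrder α] {ρ : α → ℝ} (hρ : Antitone ρ)
    (h0 : ∀ t, 0 ≤ ρ t) (h1 : ∀ t, ρ t ≤ 1) {k : ℕ} (s t : Fin k → α) (hst : ∀ i, s i < t i)
    (hts : ∀ i j, i < j → t i < s j) : |∑ i, (ρ (t i) - ρ (s i))| ≤ 1 := by
  -- The lower bound `c` lets the induction peel off the last interval, with `ρ` at its left end as
  -- the new `c`.
  have upper : ∀ k (s t : Fin k → α), (∀ i j, i < j → t i < s j) → ∀ c, c ≤ 1 →
      (∀ i, c ≤ ρ (t i)) → ∑ i, (ρ (s i) - ρ (t i)) ≤ 1 - c := by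
    intro k
    induction k with
    | zero => intro s t _ c hc _; simpa using hc
    | succ k ih =>
      intro s t hts c _ hct
      rw [Fin.sum_univ_castSucc]
      have h2 := ih (fun i => s i.castSucc) (fun i => t i.castSucc)
        (fun i j hij => hts _ _ (Fin.castSucc_lt_castSucc_iff.2 hij)) (ρ (s (Fin.last k)))
        (h1 _) (fun i => hρ (hts _ _ (Fin.castSucc_lt_last i)).le)
      linarith [hct (Fin.last k)]
  have h2 := upper k s t hts 0 zero_le_one fun i => h0 _
  have h3 : ∑ i, (ρ (t i) - ρ (s i)) = -∑ i, (ρ (s i) - ρ (t i)) := by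
    rw [← Finset.sum_neg_distrib]; simp
  have h4 : 0 ≤ ∑ i, (ρ (s i) - ρ (t i)) :=
    Finset.sum_nonneg fun i _ => sub_nonneg.2 (hρ (hst i).le)
  rw [h3, abs_neg, abs_of_nonneg h4]
  linarith

/-- Test with masses `1 / k` at the tops and `-1 / k` at the bottoms of `k > n` up-crossings: total
weight 2, distribution function at most `1 / k`, value at least `b - a`. -/
lemma IsRelativelySeqCompact.upcrossings {K : Set SkorokhodSpace}
    (hK : IsRelativelySeqCompact K) : UniformlyBoundedUpcrossings K := by
  intro T hT a b hab
  by_contra hsup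
  refine hK.false_of_sums (T := T) (sub_pos.2 hab) fun n => ?_
  obtain ⟨x, hx, k, hk, s, t, hst, hts, hab'⟩ : ∃ x ∈ K, ∃ k : ℕ, n + 1 ≤ k ∧
      ∃ s t : Fin k → Icc (0 : ℝ≥0) T, (∀ i, s i < t i) ∧ (∀ i j, i < j → t i < s j) ∧
        ∀ i, x.restrict T (s i) < a ∧ b < x.restrict T (t i) := by
    by_contra! hc
    refine hsup (lt_of_le_of_lt (iSup₂_le fun x hx => ?_) (WithTop.coe_lt_top n))
    refine iSup₂_le fun k ⟨s, t, h1, h2, h3⟩ => ?_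
    by_contra hkn
    have hkn' : n + 1 ≤ k := (Nat.cast_lt (α := ℕ∞)).1 (not_le.1 hkn)
    obtain ⟨i, hi⟩ := hc x hx k hkn' s t h1 h2
    exact (hi (h3 i).1).not_gt (h3 i).2
  have hk0 : (0 : ℝ) < k := by exact_mod_cast (Nat.succ_pos n).trans_le hk
  have hsum : ∀ g : ℝ≥0 → ℝ, ∑ i : Fin k ⊕ Fin k,
      Sum.elim (fun _ => 1 / (k : ℝ)) (fun _ => -(1 / (k : ℝ))) i *
        g (Sum.elim (fun i => (t i).1) (fun i => (s i).1) i) =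
      1 / k * ∑ i, (g (t i).1 - g (s i).1) := by
    intro g
    rw [Fintype.sum_sum_type]
    simp only [Sum.elim_inl, Sum.elim_inr]
    rw [← Finset.sum_add_distrib, Finset.mul_sum]
    exact Finset.sum_congr rfl fun i _ => by ring
  refine ⟨Fin k ⊕ Fin k, inferInstance, Sum.elim (fun _ => 1 / (k : ℝ)) (fun _ => -(1 / (k : ℝ))),
    Sum.elim (fun i => (t i).1) (fun i => (s i).1), x, hx, ?_, ?_, fun ρ hρ h0 h1 => ?_, ?_⟩
  · rintro (i | i)
    · exact (t i).2.2
    · exact (s i).2.2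
  · rw [Fintype.sum_sum_type]
    simp only [Sum.elim_inl, Sum.elim_inr, abs_neg, abs_of_pos (one_div_pos.2 hk0),
      Finset.sum_const, Finset.card_univ, Fintype.card_fin, nsmul_eq_mul]
    rw [mul_one_div_cancel hk0.ne']
    norm_num
  · rw [hsum, abs_mul, abs_of_pos (one_div_pos.2 hk0)]
    have h2 := sum_antitone_sub_le hρ h0 h1 (fun i => (s i).1) (fun i => (t i).1) hst hts
    have h3 : (n : ℝ) + 1 ≤ k := by exact_mod_cast hk
    calc _ ≤ 1 / ((n : ℝ) + 1) * 1 := by gcongr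
      _ = _ := mul_one _
  · rw [hsum]
    have h2 : ∑ _i : Fin k, (b - a) ≤ ∑ i, (x.1 (t i).1 - x.1 (s i).1) :=
      Finset.sum_le_sum fun i _ => by
        have h3 : x.1 (s i).1 < a := (hab' i).1
        have h4 : b < x.1 (t i).1 := (hab' i).2
        linarith
    rw [Finset.sum_const, Finset.card_univ, Fintype.card_fin, nsmul_eq_mul] at h2
    calc b - a = 1 / (k : ℝ) * (k * (b - a)) := by field_simp
      _ ≤ _ := by gcongr

end

end STopology

theorem theorem5p2 (K : Set STopology.SkorokhodSpace) :
    (STopology.IsRelativelySeqCompact K ↔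
      STopology.UniformlyBounded K ∧ STopology.UniformlyBoundedUpcrossings K) ∧
    (STopology.UniformlyBounded K ∧ STopology.UniformlyBoundedUpcrossings K ↔
      STopology.UniformlyBounded K ∧ STopology.UniformlyBoundedOscillations K) :=
  ⟨⟨fun h => ⟨h.uniformlyBounded, h.upcrossings⟩,
      fun h => STopology.isRelativelySeqCompact_of_oscillations h.1 (h.2.oscillations h.1)⟩,
    ⟨fun h => ⟨h.1, h.2.oscillations h.1⟩, fun h => ⟨h.1, h.2.upcrossings⟩⟩⟩
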